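/- **Theorem 3.1.** Let $\lambda>0$, $\sigma>0$, $0<h\le T$, and let $\alpha_1\neq\alpha_2$ be real numbers. On a probability space let $(\varepsilon_t)_{t\in[0,T]}$ be a continuous-time Markov chain with right-continuous paths, states $\{1,2\}$, intensity matrix $Q=\begin{pmatrix}-\lambda&\lambda\\ \lambda&-\lambda\end{pmatrix}$ and an arbitrary initial distribution $p_0$, and let $(W_t)_{t\in[0,T]}$ be a standard Brownian motion independent of $\varepsilon$. Put $$Z_h=\int_0^h\alpha_{\varepsilon_s}\,ds+\sigma W_h,\qquad a=\tfrac12(\alpha_1+\alpha_2),\quad b_1=\tfrac12(\alpha_1-\alpha_2),\quad b_2=\tfrac12(\alpha_2-\alpha_1),$$ $$B_0(z)=\sum_{k=0}^\infty\frac{(z^2/4)^k}{k!^2},\qquad B_1(z)=\frac z2\sum_{k=0}^\infty\frac{(z^2/4)^k}{k!\,(k+1)!},\qquad \phi_s(x)=\frac1{\sqrt{2\pi}\,s}e^{-\frac12\frac{x^2}{s^2}},$$ and, for $x\in(-h,h)$, $$\tilde q_{h,\lambda}(x)=\frac\lambda2\Big[B_0\big(\lambda\sqrt{h^2-x^2}\big)+\Big(\frac{h+x}{h-x}\Big)^{1/2}B_1\big(\lambda\sqrt{h^2-x^2}\big)\Big],$$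 $$\tilde q_{h,+}(x)=\frac\lambda2\Big(\frac{h+x}{h-x}\Big)^{1/2}B_1\big(\lambda\sqrt{h^2-x^2}\big),\qquad \tilde q_{h,-}(x)=\frac\lambda2B_0\big(\lambda\sqrt{h^2-x^2}\big).$$ Let $i\in\{1,2\}$ with $p_0(i)>0$. Then all integrals below converge absolutely for every $z\in\mathbb R$, the conditioning events have positive probability, and the following hold (densities with respect to Lebesgue measure). 1. A density of the conditional distribution of $Z_h$ given $\varepsilon_0=i$ is $$g_i(z,h)=e^{-\lambda h}\Big[\phi_{\sigma\sqrt h}\big(z-h(b_i+a)\big)+\frac1{|b_i|}\int_{h(a-|b_i|)}^{h(a+|b_i|)}\phi_{\sigma\sqrt h}(z-x)\,\tilde q_{h,\lambda}\Big(\frac{x-ah}{b_i}\Big)dx\Big],\quad z\in\mathbb R.$$ 2. A density of the conditional distribution of $Z_h$ given $\varepsilon_0=\varepsilon_h=i$ is $$g_{ii}(z,h)=\frac1{\cosh(\lambda h)}\Big[\phi_{\sigma\sqrt h}\big(z-h(b_i+a)\big)+\frac1{|b_i|}\int_{h(a-|b_i|)}^{h(a+|b_i|)}\phi_{\sigma\sqrt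 h}(z-x)\,\tilde q_{h,+}\Big(\frac{x-ah}{b_i}\Big)dx\Big],\quad z\in\mathbb R.$$ 3. For $j\in\{1,2\}$, $j\neq i$, a density of the conditional distribution of $Z_h$ given $\varepsilon_0=i$, $\varepsilon_h=j$ is $$g_{ij}(z,h)=\frac1{\sinh(\lambda h)\,|b_i|}\int_{h(a-|b_i|)}^{h(a+|b_i|)}\phi_{\sigma\sqrt h}(z-x)\,\tilde q_{h,-}\Big(\frac{x-ah}{b_i}\Big)dx,\quad z\in\mathbb R.$$ -/

import Mathlib

open MeasureTheory ProbabilityTheory Set Filter Topology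
open scoped NNReal ENNReal

noncomputable section

namespace TelegraphFilter

/-- `ε` is, on the time interval `[0, T]`, a time-homogeneous continuous-time Markov chain with
states `0, …, d - 1`, intensity matrix `Q` and initial distribution `p₀`: for times
`0 = t₀ ≤ t₁ ≤ ⋯ ≤ tₙ ≤ T`,
`P(ε_{t₀} = x₀, …, ε_{tₙ} = xₙ) = p₀(x₀) ∏ₖ (e^{(tₖ₊₁ - tₖ) Q})_{xₖ, xₖ₊₁}`,
and almost every path is right-continuous (for the discrete topology on the states).
The values of `ε` after time `T` play no role. -/
structure IsMarkovChainOn {Ω : Type*} [MeasurableSpace Ω] {d : ℕ}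
    (Q : Matrix (Fin d) (Fin d) ℝ) (p₀ : Fin d → ℝ) (T : ℝ≥0)
    (ε : ℝ≥0 → Ω → Fin d) (P : Measure Ω) : Prop where
  measurable : ∀ t ≤ T, Measurable (ε t)
  finiteDimensional : ∀ (n : ℕ) (t : Fin (n + 1) → ℝ≥0), Monotone t → t 0 = 0 →
    t (Fin.last n) ≤ T → ∀ x : Fin (n + 1) → Fin d,
      P.real {ω | ∀ k, ε (t k) ω = x k} =
        p₀ (x 0) * ∏ k : Fin n,
          NormedSpace.exp (((t k.succ : ℝ) - (t k.castSucc : ℝ)) • Q) (x k.castSucc) (x k.succ)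
  rightContinuous : ∀ᵐ ω ∂P, ∀ t < T, ContinuousWithinAt (fun s => ε s ω) (Ici t) t

/-- `W` is a standard real Brownian motion on the time interval `[0, T]`: Mathlib's
`IsBrownianReal` with all times restricted to `[0, T]`, that is, the finite-dimensional laws are
those of Brownian motion and almost every path is continuous. -/
structure IsBrownianOn {Ω : Type*} [MeasurableSpace Ω] (T : ℝ≥0)
    (W : ℝ≥0 → Ω → ℝ) (P : Measure Ω) : Prop where
  hasLaw : ∀ I : Finset ℝ≥0, (∀ t ∈ I, t ≤ T) →
    HasLaw (fun ω => I.restrict (fun t => W t ω)) (BrownianReal.projectiveFamily I) P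
  continuous : ∀ᵐ ω ∂P, ContinuousOn (fun t => W t ω) (Icc 0 T)

/-- The observation `Z_t = ∫₀ᵗ α_{ε_s} ds + σ W_t`. -/
def observation {Ω : Type*} {d : ℕ} (α : Fin d → ℝ) (σ : ℝ) (ε : ℝ≥0 → Ω → Fin d)
    (W : ℝ≥0 → Ω → ℝ) (t : ℝ≥0) (ω : Ω) : ℝ :=
  (∫ s in (0 : ℝ)..t, α (ε s.toNNReal ω)) + σ * W t ω

/-- `g` is a density, with respect to Lebesgue measure, of the conditional distribution of `X`
given the event `A` of positive probability. -/
structure HasCondDensity {Ω : Type*} [MeasurableSpace Ω] (X : Ω → ℝ) (P : Measure Ω)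
    (A : Set Ω) (g : ℝ → ℝ) : Prop where
  event_pos : P A ≠ 0
  measurable : Measurable g
  nonneg : ∀ z, 0 ≤ g z
  hasLaw : HasLaw X (volume.withDensity fun z => ENNReal.ofReal (g z)) (P[|A])

/-- The symmetric intensity matrix with switching rate `l`. -/
def symmetricQ (l : ℝ) : Matrix (Fin 2) (Fin 2) ℝ := !![-l, l; l, -l]

/-- The modified Bessel function `B₀(z) = ∑ₖ (z²/4)ᵏ / (k!)²`. -/
def besselB0 (z : ℝ) : ℝ := ∑' k : ℕ, (z ^ 2 / 4) ^ k / (k.factorial : ℝ) ^ 2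

/-- The modified Bessel function `B₁(z) = (z/2) ∑ₖ (z²/4)ᵏ / (k! (k+1)!)`. -/
def besselB1 (z : ℝ) : ℝ :=
  z / 2 * ∑' k : ℕ, (z ^ 2 / 4) ^ k / ((k.factorial : ℝ) * ((k + 1).factorial : ℝ))

/-- The density `φ_s` of the normal distribution with expectation `0`, standard deviation `s`. -/
def phi (s x : ℝ) : ℝ := 1 / (√(2 * Real.pi) * s) * Real.exp (-(1 / 2) * (x ^ 2 / s ^ 2))

/-- `a = (α₁ + α₂) / 2`. -/
def mean (α : Fin 2 → ℝ) : ℝ := (α 0 + α 1) / 2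

/-- `b₁ = (α₁ - α₂) / 2` and `b₂ = (α₂ - α₁) / 2`. -/
def halfDiff (α : Fin 2 → ℝ) : Fin 2 → ℝ := ![(α 0 - α 1) / 2, (α 1 - α 0) / 2]

/-- The kernel `q̃_{h,λ}` (here `l` is the switching rate `λ`). -/
def qTotal (h l x : ℝ) : ℝ :=
  l / 2 * (besselB0 (l * √(h ^ 2 - x ^ 2))
    + √((h + x) / (h - x)) * besselB1 (l * √(h ^ 2 - x ^ 2)))

/-- The kernel `q̃_{h,+}`. -/
def qPlus (h l x : ℝ) : ℝ :=
  l / 2 * √((h + x) / (h - x)) * besselB1 (√(h ^ 2 - x ^ 2) * l)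

/-- The kernel `q̃_{h,-}`. -/
def qMinus (h l x : ℝ) : ℝ := l / 2 * besselB0 (√(h ^ 2 - x ^ 2) * l)

/-- The function `x ↦ φ_{σ√h}(z - x) q((x - a h) / b)`. -/
def convIntegrand (a b σ h : ℝ) (q : ℝ → ℝ) (z x : ℝ) : ℝ :=
  phi (σ * √h) (z - x) * q ((x - a * h) / b)

/-- `∫ φ_{σ√h}(z - x) q((x - a h) / b) dx` over `h (a - |b|) ≤ x ≤ h (a + |b|)`. -/
def convIntegral (a b σ h : ℝ) (q : ℝ → ℝ) (z : ℝ) : ℝ :=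
  ∫ x in (h * (a - |b|))..(h * (a + |b|)), convIntegrand a b σ h q z x

/-- The claimed density `g_i(z, h)`, in terms of `a`, `b = b_i`, `σ`, `l = λ`, `h`. -/
def gInit (a b σ l h z : ℝ) : ℝ :=
  Real.exp (-l * h) * (phi (σ * √h) (z - h * (b + a))
    + 1 / |b| * convIntegral a b σ h (qTotal h l) z)

/-- The claimed density `g_{ii}(z, h)`. -/
def gSame (a b σ l h z : ℝ) : ℝ :=
  1 / Real.cosh (l * h) * (phi (σ * √h) (z - h * (b + a))
    + 1 / |b| * convIntegral a b σ h (qPlus h l) z)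

/-- The claimed density `g_{ij}(z, h)`, `i ≠ j`. -/
def gDiff (a b σ l h z : ℝ) : ℝ :=
  1 / (Real.sinh (l * h) * |b|) * convIntegral a b σ h (qMinus h l) z

end TelegraphFilter

end

/-! Since the chain has two states, `∫₀ʰ α_{ε_s} ds = α_j h + (α_i - α_j) U`, where `U` is the time
spent in the initial state `i` before `h` and `j` is the other state. With `a` and `b = b_i` this
reads `Z_h = (a - b) h + 2 b U + σ W_h`. By independence, each claim reduces to the law of `U` on an
event fixed by `ε_0` and `ε_h`, followed by a Gaussian convolution and the substitution `x = (a - b)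
h + 2 b u`.

Heuristically, `2k + 1` jumps split `[0, h]` into `k + 1` sojourns in each state, and simplex
volumes give the weight `e^{-λh} λ^{2k+1} (u^k / k!) ((h - u)^k / k!)`. With `2k + 2` jumps there is
one more sojourn in `i`, so `u^k / k!` becomes `u^{k+1} / (k+1)!`. No jump gives an atom at `u = h`.
Summing over `k` yields the Bessel kernels.

The proof avoids jump times and compares Laplace transforms instead. Replacing `U` by Riemann sums,
the finite-dimensional laws express `E[e^{θU}; ε_0 = i, ε_h = k]` through an entry of `(e^{hQ/n}
e^{hD/n})^n`, with `D` diagonal and `θ` at `i`. The Lie-Trotter limit is `e^{h(Q + D)}`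
(`setIntegral_exp_occupationTime`). Uniqueness for a linear ODE identifies the entries with the
series above (`exp_symmetricQ_add_occupationMatrix`), which are also the transforms of the kernels,
integrated term by term. A finite measure is determined by its everywhere finite moment generating
function (`measure_eq_of_integral_exp_eq`), so the law of `U` follows.
`hasCondDensity_of_integral_exp` turns this into a conditional density of `Z_h`. -/

noncomputable section

/-! ### Chernoff's product formula in a Banach algebra -/

section Chernoff

variable {𝔸 : Type*} [NormedRing 𝔸]

/-- Telescoping: exchanging the factors one at a time costs `‖a - b‖` at each of the `n + 1` places,
while the `n` other factors are bounded by `C`. -/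
theorem norm_pow_sub_pow_le_of_norm_le [NormOneClass 𝔸] {a b : 𝔸} {C : ℝ} (ha : ‖a‖ ≤ C)
    (hb : ‖b‖ ≤ C) (n : ℕ) : ‖a ^ (n + 1) - b ^ (n + 1)‖ ≤ (n + 1) * C ^ n * ‖a - b‖ := by
  have hC : 0 ≤ C := (norm_nonneg a).trans ha
  induction n with
  | zero => simp
  | succ n ih =>
    have h : a ^ (n + 1 + 1) - b ^ (n + 1 + 1)
        = a * (a ^ (n + 1) - b ^ (n + 1)) + (a - b) * b ^ (n + 1) := by
      rw [pow_succ' a (n + 1), pow_succ' b (n + 1)]; noncomm_ring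
    rw [h]
    calc _ ≤ ‖a‖ * ‖a ^ (n + 1) - b ^ (n + 1)‖ + ‖a - b‖ * ‖b ^ (n + 1)‖ :=
          (norm_add_le _ _).trans (add_le_add (norm_mul_le _ _) (norm_mul_le _ _))
      _ ≤ C * ((n + 1) * C ^ n * ‖a - b‖) + ‖a - b‖ * C ^ (n + 1) := by
          gcongr
          exact (norm_pow_le _ _).trans (pow_le_pow_left₀ (norm_nonneg _) hb _)
      _ = _ := by push_cast; ring

/-- If `f 0 = 1` and `f' 0 = Z`, then `f (1 / n) ^ n` tends to `exp Z`. -/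
theorem HasDerivAt.tendsto_inv_pow_exp [NormedAlgebra ℝ 𝔸] [NormOneClass 𝔸] [CompleteSpace 𝔸]
    {f : ℝ → 𝔸} {Z : 𝔸} (hf : HasDerivAt f Z 0) (hf0 : f 0 = 1) :
    Tendsto (fun n : ℕ => f (1 / ((n : ℝ) + 1)) ^ (n + 1)) atTop (𝓝 (NormedSpace.exp Z)) := by
  let _ : NormedAlgebra ℚ 𝔸 := NormedAlgebra.restrictScalars ℚ ℝ 𝔸
  set g : ℝ → 𝔸 := fun t => NormedSpace.exp (t • Z) with hg
  have hg' : HasDerivAt g Z 0 := by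
    simpa [NormedSpace.exp_zero] using hasDerivAt_exp_smul_const (𝕂 := ℝ) Z 0
  have hg0 : g 0 = 1 := by simp [hg, NormedSpace.exp_zero]
  have hlim : Tendsto (fun n : ℕ => 1 / ((n : ℝ) + 1)) atTop (𝓝 0) :=
    tendsto_one_div_add_atTop_nhds_zero_nat
  have key : ∀ k : ℝ → 𝔸, HasDerivAt k Z 0 → k 0 = 1 →
      ∀ᶠ t in 𝓝 (0 : ℝ), ‖k t‖ ≤ 1 + (‖Z‖ + 1) * |t| := by
    intro k hk hk0
    have h := hk.isLittleO.bound (c := 1) one_pos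
    filter_upwards [h] with t ht
    simp only [sub_zero, hk0, one_mul, Real.norm_eq_abs] at ht
    have e : k t = (k t - 1 - t • Z) + (1 + t • Z) := by abel
    calc ‖k t‖ = ‖(k t - 1 - t • Z) + (1 + t • Z)‖ := by rw [← e]
      _ ≤ |t| + (1 + |t| * ‖Z‖) := by
        refine (norm_add_le _ _).trans (add_le_add ht ((norm_add_le _ _).trans ?_))
        rw [norm_one, norm_smul, Real.norm_eq_abs]
      _ = _ := by ring
  have hpow : ∀ n : ℕ, g (1 / ((n : ℝ) + 1)) ^ (n + 1) = NormedSpace.exp Z := by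
    intro n
    rw [hg, ← NormedSpace.exp_nsmul, ← Nat.cast_smul_eq_nsmul ℝ, smul_smul]
    have : ((n : ℝ) + 1) ≠ 0 := by positivity
    push_cast
    rw [mul_one_div_cancel this, one_smul]
  rw [tendsto_iff_norm_sub_tendsto_zero]
  have hdiff : (fun t => f t - g t) =o[𝓝 0] fun t => t := by
    have h := hf.isLittleO.sub hg'.isLittleO
    simpa [hf0, hg0] using h
  rw [Metric.tendsto_nhds]
  intro η hη
  -- `K` bounds `(1 + (‖Z‖ + 1) t)^n` for `t = 1 / (n + 1)`, uniformly in `n`. The one-step error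
  -- `o(t)` is thus multiplied by at most `(n + 1) K`, which explains the choice `η / (2K)`.
  set K := Real.exp (‖Z‖ + 1) with hK
  have h1 := hlim.eventually (hdiff.bound (c := η / (2 * K)) (by positivity))
  filter_upwards [h1, hlim.eventually (key f hf hf0), hlim.eventually (key g hg' hg0)]
    with n h1 h2 h3
  set t : ℝ := 1 / ((n : ℝ) + 1) with ht
  have htpos : 0 < t := by positivity
  rw [Real.norm_eq_abs, abs_of_pos htpos] at h1
  rw [abs_of_pos htpos] at h2 h3
  have hb := norm_pow_sub_pow_le_of_norm_le h2 h3 n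
  rw [hpow] at hb
  have hC : (1 + (‖Z‖ + 1) * t) ^ n ≤ K := by
    calc (1 + (‖Z‖ + 1) * t) ^ n ≤ (Real.exp ((‖Z‖ + 1) * t)) ^ n := by
          gcongr
          linarith [Real.add_one_le_exp ((‖Z‖ + 1) * t)]
      _ = Real.exp (n * ((‖Z‖ + 1) * t)) := by rw [← Real.exp_nat_mul]
      _ ≤ K := by
          apply Real.exp_le_exp.mpr
          have : (n : ℝ) * t ≤ 1 := by
            rw [ht, mul_one_div, div_le_one (by positivity)]; linarith
          nlinarith [norm_nonneg Z]
  rw [Real.dist_eq, sub_zero, abs_of_nonneg (norm_nonneg _)]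
  calc _ ≤ _ := hb
    _ ≤ (n + 1) * K * (η / (2 * K) * t) := by gcongr
    _ = η / 2 := by
      have hK0 : K ≠ 0 := (Real.exp_pos _).ne'
      rw [ht]; field_simp
    _ < η := by linarith

end Chernoff

/-! ### Repeated integration -/

section RepeatedIntegral

/-- The antiderivative that vanishes at `0`. -/
def primitive (f : ℝ → ℝ) (t : ℝ) : ℝ := ∫ u in (0 : ℝ)..t, f u

theorem hasDerivAt_primitive {f : ℝ → ℝ} (hf : Continuous f) (t : ℝ) :
    HasDerivAt (primitive f) (f t) t :=
  intervalIntegral.integral_hasDerivAt_right (hf.intervalIntegrable _ _)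
    (hf.stronglyMeasurableAtFilter _ _) hf.continuousAt

theorem continuous_primitive {f : ℝ → ℝ} (hf : Continuous f) : Continuous (primitive f) :=
  continuous_iff_continuousAt.mpr fun t => (hasDerivAt_primitive hf t).continuousAt

theorem continuous_primitive_iterate {f : ℝ → ℝ} (hf : Continuous f) (n : ℕ) :
    Continuous (primitive^[n] f) := by
  induction n with
  | zero => exact hf
  | succ n ih => rw [Function.iterate_succ_apply']; exact continuous_primitive ih

/-- Cauchy's formula for repeated integration. -/
theorem primitive_iterate_eq {f : ℝ → ℝ} (hf : Continuous f) (n : ℕ) (t : ℝ) :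
    primitive^[n + 1] f t = ∫ u in (0 : ℝ)..t, f u * ((t - u) ^ n / n.factorial) := by
  induction n generalizing f with
  | zero => simp [primitive]
  | succ n ih =>
    rw [Function.iterate_succ_apply, ih (continuous_primitive hf)]
    have hd : ∀ u ∈ uIcc 0 t, HasDerivAt (fun u => -((t - u) ^ (n + 1) / (n + 1).factorial))
        ((t - u) ^ n / n.factorial) u := by
      intro u _
      have h := ((((hasDerivAt_id u).const_sub t).pow (n + 1)).div_const
        ((n + 1).factorial : ℝ)).neg
      convert! h using 1
      rw [Nat.factorial_succ]
      push_cast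
      simp only [id]
      field_simp
    rw [intervalIntegral.integral_mul_deriv_eq_deriv_mul
      (fun u _ => hasDerivAt_primitive hf u) hd (hf.intervalIntegrable _ _)
      (Continuous.intervalIntegrable (by fun_prop) _ _)]
    simp [primitive]

end RepeatedIntegral

/-! ### The jump-number series and their differential equations -/

section TelegraphSeries

/-- The function `u ↦ uᵐ e^{θ u} / m!`. -/
def expMonomial (θ : ℝ) (m : ℕ) (u : ℝ) : ℝ := u ^ m / m.factorial * Real.exp (θ * u)

/-- The convolution on `[0, t]` of `u ↦ uᵐ e^{θ u} / m!` with `v ↦ vⁿ / n!`, defined as a repeated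
integral. -/
def expConv (θ : ℝ) (m n : ℕ) : ℝ → ℝ := primitive^[n + 1] (expMonomial θ m)

theorem continuous_expMonomial (θ : ℝ) (m : ℕ) : Continuous (expMonomial θ m) := by
  unfold expMonomial; fun_prop

theorem hasDerivAt_expMonomial_succ (θ : ℝ) (m : ℕ) (t : ℝ) :
    HasDerivAt (expMonomial θ (m + 1)) (θ * expMonomial θ (m + 1) t + expMonomial θ m t) t := by
  have h := ((hasDerivAt_pow (m + 1) t).div_const ((m + 1).factorial : ℝ)).mul
    (((hasDerivAt_id t).const_mul θ).exp)
  refine h.congr_deriv ?_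
  simp only [expMonomial, Nat.factorial_succ, id]
  push_cast
  field_simp
  ring

theorem continuous_expConv (θ : ℝ) (m n : ℕ) : Continuous (expConv θ m n) :=
  continuous_primitive_iterate (continuous_expMonomial θ m) _

theorem expConv_eq (θ : ℝ) (m n : ℕ) (t : ℝ) :
    expConv θ m n t = ∫ u in (0 : ℝ)..t, expMonomial θ m u * ((t - u) ^ n / n.factorial) :=
  primitive_iterate_eq (continuous_expMonomial θ m) n t

theorem expConv_zero (θ : ℝ) (m n : ℕ) : expConv θ m n 0 = 0 := by
  rw [expConv_eq, intervalIntegral.integral_same]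

theorem hasDerivAt_expConv_zero (θ : ℝ) (m : ℕ) (t : ℝ) :
    HasDerivAt (expConv θ m 0) (expMonomial θ m t) t :=
  hasDerivAt_primitive (continuous_expMonomial θ m) t

theorem hasDerivAt_expConv_succ (θ : ℝ) (m n : ℕ) (t : ℝ) :
    HasDerivAt (expConv θ m (n + 1)) (expConv θ m n t) t := by
  unfold expConv
  rw [Function.iterate_succ_apply' _ (n + 1)]
  exact hasDerivAt_primitive (continuous_expConv θ m n) t

theorem eq_of_hasDerivAt_eq {f g f' : ℝ → ℝ} (hf : ∀ t, HasDerivAt f (f' t) t)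
    (hg : ∀ t, HasDerivAt g (f' t) t) (h0 : f 0 = g 0) : f = g := by
  ext t
  have h := is_const_of_deriv_eq_zero (f := f - g)
    (fun t => ((hf t).sub (hg t)).differentiableAt)
    (fun t => by simpa using ((hf t).sub (hg t)).deriv) t 0
  simp only [Pi.sub_apply, h0, sub_self] at h
  linarith

/-- A convolution may be differentiated through its first factor; no boundary term appears because
`u^{m+1}` vanishes at `0`. For each `n` the identity comes from comparing antiderivatives that agree
at `0`. -/
theorem hasDerivAt_expConv (θ : ℝ) (m n : ℕ) (t : ℝ) :
    HasDerivAt (expConv θ (m + 1) n) (θ * expConv θ (m + 1) n t + expConv θ m n t) t := by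
  induction n generalizing t with
  | zero =>
    have h : expMonomial θ (m + 1) = fun t => θ * expConv θ (m + 1) 0 t + expConv θ m 0 t :=
      eq_of_hasDerivAt_eq (hasDerivAt_expMonomial_succ θ m)
        (fun t => ((hasDerivAt_expConv_zero θ (m + 1) t).const_mul θ).add
          (hasDerivAt_expConv_zero θ m t))
        (by simp [expMonomial, expConv_zero])
    rw [← congrFun h t]
    exact hasDerivAt_expConv_zero θ (m + 1) t
  | succ n ih =>
    have h : expConv θ (m + 1) n =
        fun t => θ * expConv θ (m + 1) (n + 1) t + expConv θ m (n + 1) t :=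
      eq_of_hasDerivAt_eq ih
        (fun t => ((hasDerivAt_expConv_succ θ (m + 1) n t).const_mul θ).add
          (hasDerivAt_expConv_succ θ m n t))
        (by simp [expConv_zero])
    rw [← congrFun h t]
    exact hasDerivAt_expConv_succ θ (m + 1) n t

theorem abs_expMonomial_le (θ : ℝ) (m : ℕ) {H u : ℝ} (hu : |u| ≤ H) :
    |expMonomial θ m u| ≤ H ^ m / m.factorial * Real.exp (|θ| * H) := by
  have hH : 0 ≤ H := (abs_nonneg u).trans hu
  rw [expMonomial, abs_mul, abs_div, abs_pow, Nat.abs_cast, Real.abs_exp]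
  have h : θ * u ≤ |θ| * H := (le_abs_self _).trans (by rw [abs_mul]; gcongr)
  gcongr

theorem abs_expMonomial_mul_le (θ : ℝ) (m n : ℕ) {H t u : ℝ} (ht : |t| ≤ H) (hu : u ∈ uIoc 0 t) :
    |expMonomial θ m u * ((t - u) ^ n / n.factorial)|
      ≤ H ^ m / m.factorial * (Real.exp (|θ| * H) * Real.exp H) := by
  have hH : 0 ≤ H := (abs_nonneg t).trans ht
  have h1 : |u| ≤ H := by rcases mem_uIoc.mp hu with hu | hu <;> grind
  have h2 : |t - u| ≤ H := by rcases mem_uIoc.mp hu with hu | hu <;> grind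
  rw [abs_mul, abs_div, abs_pow, Nat.abs_cast, ← mul_assoc]
  gcongr
  · exact abs_expMonomial_le θ m h1
  · calc |t - u| ^ n / n.factorial ≤ H ^ n / n.factorial := by gcongr
      _ ≤ Real.exp H := Real.pow_div_factorial_le_exp H hH n

/-- The factor `(t - u)^n / n!` is absorbed into `e^H`. The remaining `H^m / m!` alone makes the
series over the number of jumps summable, uniformly for `|t| ≤ H`. -/
theorem abs_expConv_le (θ : ℝ) (m n : ℕ) {H t : ℝ} (ht : |t| ≤ H) :
    |expConv θ m n t| ≤ H ^ m / m.factorial * (Real.exp (|θ| * H) * Real.exp H * H) := by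
  have hH : 0 ≤ H := (abs_nonneg t).trans ht
  rw [expConv_eq, ← Real.norm_eq_abs]
  calc _ ≤ H ^ m / m.factorial * (Real.exp (|θ| * H) * Real.exp H) * |t - 0| :=
        intervalIntegral.norm_integral_le_of_norm_le_const
          fun u hu => abs_expMonomial_mul_le θ m n ht hu
    _ ≤ H ^ m / m.factorial * (Real.exp (|θ| * H) * Real.exp H) * H := by
        rw [sub_zero]; gcongr
    _ = _ := by ring

/-- The contribution of an even number of jumps to `e^{λ t} E[e^{θ U_t}]`, where `U_t` is the
occupation time of the initial state. -/
def evenSeries (θ l t : ℝ) : ℝ :=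
  Real.exp (θ * t) + ∑' k : ℕ, l ^ (2 * k + 2) * expConv θ (k + 1) k t

/-- The contribution of an odd number of jumps to `e^{λ t} E[e^{θ U_t}]`. -/
def oddSeries (θ l t : ℝ) : ℝ := ∑' k : ℕ, l ^ (2 * k + 1) * expConv θ k k t

theorem summable_pow_mul_pow_div_factorial (l H : ℝ) :
    Summable fun k : ℕ => |l| ^ (2 * k) * (H ^ k / k.factorial) := by
  refine (Real.summable_pow_div_factorial (|l| ^ 2 * H)).congr fun k => ?_
  rw [mul_pow, ← pow_mul]; ring

theorem summable_pow_mul_pow_succ_div_factorial (l H : ℝ) :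
    Summable fun k : ℕ => |l| ^ (2 * k + 2) * (H ^ (k + 1) / (k + 1).factorial) :=
  (summable_nat_add_iff 1).mpr (summable_pow_mul_pow_div_factorial l H)

theorem summable_odd (θ l t : ℝ) :
    Summable fun k : ℕ => l ^ (2 * k + 1) * expConv θ k k t := by
  refine Summable.of_norm_bounded (((summable_pow_mul_pow_div_factorial l |t|).mul_left
    (|l| * (Real.exp (|θ| * |t|) * Real.exp |t| * |t|)))) fun k => ?_
  rw [norm_mul, Real.norm_eq_abs, Real.norm_eq_abs, abs_pow]
  calc _ ≤ |l| ^ (2 * k + 1) * (|t| ^ k / k.factorial *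
          (Real.exp (|θ| * |t|) * Real.exp |t| * |t|)) := by
        gcongr; exact abs_expConv_le θ k k le_rfl
    _ = _ := by ring

theorem summable_even (θ l t : ℝ) :
    Summable fun k : ℕ => l ^ (2 * k + 2) * expConv θ (k + 1) k t := by
  refine Summable.of_norm_bounded (((summable_pow_mul_pow_succ_div_factorial l |t|).mul_left
    (Real.exp (|θ| * |t|) * Real.exp |t| * |t|))) fun k => ?_
  rw [norm_mul, Real.norm_eq_abs, Real.norm_eq_abs, abs_pow]
  calc _ ≤ |l| ^ (2 * k + 2) * (|t| ^ (k + 1) / (k + 1).factorial *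
          (Real.exp (|θ| * |t|) * Real.exp |t| * |t|)) := by
        gcongr; exact abs_expConv_le θ (k + 1) k le_rfl
    _ = _ := by ring

theorem evenSeries_zero (θ l : ℝ) : evenSeries θ l 0 = 1 := by
  simp [evenSeries, expConv_zero]

theorem oddSeries_zero (θ l : ℝ) : oddSeries θ l 0 = 0 := by
  simp [oddSeries, expConv_zero]

/-- Together with the equation for `oddSeries`, this is the forward equation of `Q + D` with the
factor `e^{-λt}` removed. -/
theorem hasDerivAt_evenSeries (θ l t : ℝ) :
    HasDerivAt (evenSeries θ l) (θ * evenSeries θ l t + l * oddSeries θ l t) t := by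
  -- Termwise differentiation needs a summable bound on the derivatives over an open set containing
  -- `t`; a ball of radius `|t| + 1` is such a set.
  set H := |t| + 1
  set E := Real.exp (|θ| * H) * Real.exp H * H
  have ht : t ∈ Metric.ball (0 : ℝ) H := by simp [H]
  have hd := hasDerivAt_tsum_of_isPreconnected
    (u := fun k : ℕ => |θ| * E * (|l| ^ (2 * k + 2) * (H ^ (k + 1) / (k + 1).factorial))
      + |l| ^ 2 * E * (|l| ^ (2 * k) * (H ^ k / k.factorial)))
    (g := fun k t => l ^ (2 * k + 2) * expConv θ (k + 1) k t)
    (g' := fun k t => l ^ (2 * k + 2) * (θ * expConv θ (k + 1) k t + expConv θ k k t))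
    (((summable_pow_mul_pow_succ_div_factorial l H).mul_left _).add
      ((summable_pow_mul_pow_div_factorial l H).mul_left _))
    Metric.isOpen_ball (convex_ball (0 : ℝ) H).isPreconnected
    (fun k y _ => (hasDerivAt_expConv θ k k y).const_mul _)
    (fun k y hy => by
      have hy' : |y| ≤ H := by simpa using (mem_ball_zero_iff.mp hy).le
      rw [norm_mul, norm_pow, Real.norm_eq_abs, Real.norm_eq_abs]
      calc _ ≤ |l| ^ (2 * k + 2) * (|θ| * (H ^ (k + 1) / (k + 1).factorial * E)
            + H ^ k / k.factorial * E) := by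
            gcongr
            refine (abs_add_le _ _).trans (add_le_add ?_ (abs_expConv_le θ k k hy'))
            rw [abs_mul]
            gcongr
            exact abs_expConv_le θ (k + 1) k hy'
        _ = _ := by ring)
    ht (summable_even θ l t) ht
  have h := (((hasDerivAt_id t).const_mul θ).exp).add hd
  refine h.congr_deriv ?_
  have h1 : ∑' k : ℕ, l ^ (2 * k + 2) * (θ * expConv θ (k + 1) k t + expConv θ k k t)
      = θ * ∑' k : ℕ, l ^ (2 * k + 2) * expConv θ (k + 1) k t + l * oddSeries θ l t := by
    rw [oddSeries, ← tsum_mul_left, ← tsum_mul_left,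
      ← ((summable_even θ l t).mul_left θ).tsum_add ((summable_odd θ l t).mul_left l)]
    exact tsum_congr fun k => by ring
  rw [h1, evenSeries]
  simp only [id]
  ring

theorem hasDerivAt_oddSeries (θ l t : ℝ) :
    HasDerivAt (oddSeries θ l) (l * evenSeries θ l t) t := by
  set H := |t| + 1
  set E := Real.exp (|θ| * H) * Real.exp H * H
  have ht : t ∈ Metric.ball (0 : ℝ) H := by simp [H]
  have hd := hasDerivAt_tsum_of_isPreconnected
    (u := fun k : ℕ => |l| * E * (|l| ^ (2 * k + 2) * (H ^ (k + 1) / (k + 1).factorial)))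
    (g := fun k t => l ^ (2 * (k + 1) + 1) * expConv θ (k + 1) (k + 1) t)
    (g' := fun k t => l ^ (2 * (k + 1) + 1) * expConv θ (k + 1) k t)
    ((summable_pow_mul_pow_succ_div_factorial l H).mul_left _)
    Metric.isOpen_ball (convex_ball (0 : ℝ) H).isPreconnected
    (fun k y _ => (hasDerivAt_expConv_succ θ (k + 1) k y).const_mul _)
    (fun k y hy => by
      have hy' : |y| ≤ H := by simpa using (mem_ball_zero_iff.mp hy).le
      rw [norm_mul, norm_pow, Real.norm_eq_abs, Real.norm_eq_abs]
      calc _ ≤ |l| ^ (2 * (k + 1) + 1) * (H ^ (k + 1) / (k + 1).factorial * E) := by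
            gcongr
            exact abs_expConv_le θ (k + 1) k hy'
        _ = _ := by ring)
    ht ((summable_nat_add_iff 1).mpr (summable_odd θ l t)) ht
  -- The term `k = 0` is treated apart: its derivative is the bare exponential, which supplies the
  -- leading term of `evenSeries`, whereas the later terms differentiate into convolutions.
  have h := ((hasDerivAt_expConv_zero θ 0 t).const_mul l).add hd
  have e : oddSeries θ l = fun t => l * expConv θ 0 0 t
      + ∑' k : ℕ, l ^ (2 * (k + 1) + 1) * expConv θ (k + 1) (k + 1) t := by
    ext t
    rw [oddSeries, (summable_odd θ l t).tsum_eq_zero_add]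
    simp
  rw [e]
  refine h.congr_deriv ?_
  rw [evenSeries, mul_add, ← tsum_mul_left]
  congr 1
  · simp [expMonomial]
  · exact tsum_congr fun k => by ring

end TelegraphSeries

/-! ### Entries of the matrix exponentials -/

section MatrixExponential

open scoped Matrix.Norms.Operator in
/-- A solution of the forward equation `y' = y C` started in the `i`-th unit vector is the `i`-th
row of `exp (t C)`. -/
theorem eq_exp_smul_row {d : ℕ} (C : Matrix (Fin d) (Fin d) ℝ) (i : Fin d)
    {y : ℝ → Fin d → ℝ} (h0 : y 0 = Pi.single i 1)
    (hy : ∀ t k, HasDerivAt (fun s => y s k) (∑ m, y t m * C m k) t) (t : ℝ) :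
    y t = NormedSpace.exp (t • C) i := by
  have hlin := (LinearMap.toContinuousLinearMap C.vecMulLinear).lipschitz
  have h : y = fun t => NormedSpace.exp (t • C) i := by
    refine ODE_solution_unique_univ (v := fun _ x => Matrix.vecMul x C) (s := fun _ => univ)
      (t₀ := 0) (fun t => hlin.lipschitzOnWith) (fun t => ⟨?_, mem_univ _⟩)
      (fun t => ⟨?_, mem_univ _⟩) ?_
    · rw [hasDerivAt_pi]
      intro k
      simpa [Matrix.vecMul, dotProduct] using hy t k
    · have h := hasDerivAt_exp_smul_const (𝕂 := ℝ) C t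
      exact (hasDerivAt_pi.mp h) i
    · rw [h0]
      ext k
      simp [NormedSpace.exp_zero, Matrix.one_apply, Pi.single_apply, eq_comm]
  exact congrFun h t

/-- The diagonal matrix with a single nonzero entry `θ` at `i`. -/
def occupationMatrix (θ : ℝ) (i : Fin 2) : Matrix (Fin 2) (Fin 2) ℝ :=
  Matrix.diagonal fun k => if k = i then θ else 0

/-- The right-hand side starts at the `i`-th unit vector and solves the forward equation, by the two
derivative formulas for the series. -/
theorem exp_symmetricQ_add_occupationMatrix (θ l t : ℝ) (i k : Fin 2) :
    NormedSpace.exp (t • (TelegraphFilter.symmetricQ l + occupationMatrix θ i)) i k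
      = Real.exp (-l * t) * if k = i then evenSeries θ l t else oddSeries θ l t := by
  rw [← eq_exp_smul_row (TelegraphFilter.symmetricQ l + occupationMatrix θ i) i
    (y := fun t k => Real.exp (-l * t) * if k = i then evenSeries θ l t else oddSeries θ l t)]
  · ext k
    simp [evenSeries_zero, oddSeries_zero, Pi.single_apply]
  · intro t k
    have he : HasDerivAt (fun t => Real.exp (-(l * t))) (Real.exp (-(l * t)) * -l) t := by
      simpa using (((hasDerivAt_id t).const_mul l).neg.exp)
    have h1 := he.mul (hasDerivAt_evenSeries θ l t)
    have h2 := he.mul (hasDerivAt_oddSeries θ l t)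
    fin_cases i <;> fin_cases k <;>
      simp [TelegraphFilter.symmetricQ, occupationMatrix, Matrix.diagonal]
    · refine h1.congr_deriv ?_; ring
    · refine h2.congr_deriv ?_; ring
    · refine h2.congr_deriv ?_; ring
    · refine h1.congr_deriv ?_; ring

theorem exp_symmetricQ (l t : ℝ) (i k : Fin 2) :
    NormedSpace.exp (t • TelegraphFilter.symmetricQ l) i k
      = Real.exp (-l * t) * if k = i then Real.cosh (l * t) else Real.sinh (l * t) := by
  rw [← eq_exp_smul_row (TelegraphFilter.symmetricQ l) i
    (y := fun t k => Real.exp (-l * t) * if k = i then Real.cosh (l * t) else Real.sinh (l * t))]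
  · ext k
    simp [Pi.single_apply]
  · intro t k
    have he : HasDerivAt (fun t => Real.exp (-(l * t))) (Real.exp (-(l * t)) * -l) t := by
      simpa using (((hasDerivAt_id t).const_mul l).neg.exp)
    have h1 := he.mul ((hasDerivAt_id t).const_mul l).cosh
    have h2 := he.mul ((hasDerivAt_id t).const_mul l).sinh
    simp only [id, mul_one] at h1 h2
    fin_cases i <;> fin_cases k <;> simp [TelegraphFilter.symmetricQ]
    · refine h1.congr_deriv ?_; ring
    · refine h2.congr_deriv ?_; ring
    · refine h2.congr_deriv ?_; ring
    · refine h1.congr_deriv ?_; ring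

end MatrixExponential

/-! ### Bessel kernels and their Laplace transforms -/

section BesselKernels

/-- The entire function `y ↦ ∑ₖ yᵏ / (k!)²`. -/
def besselSum0 (y : ℝ) : ℝ := ∑' k : ℕ, y ^ k / (k.factorial : ℝ) ^ 2

/-- The entire function `y ↦ ∑ₖ yᵏ / (k! (k + 1)!)`. -/
def besselSum1 (y : ℝ) : ℝ :=
  ∑' k : ℕ, y ^ k / ((k.factorial : ℝ) * ((k + 1).factorial : ℝ))

theorem abs_pow_div_factorial_mul_le (y : ℝ) {M c : ℝ} (hy : |y| ≤ M) (hc : 1 ≤ c) (k : ℕ) :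
    |y ^ k / ((k.factorial : ℝ) * c)| ≤ M ^ k / k.factorial := by
  have hk : (0 : ℝ) < k.factorial := by positivity
  rw [abs_div, abs_pow, abs_of_pos (by positivity : 0 < (k.factorial : ℝ) * c)]
  have hM : 0 ≤ M := (abs_nonneg y).trans hy
  gcongr
  exact le_mul_of_one_le_right hk.le hc

theorem continuous_tsum_pow_div_factorial_mul {c : ℕ → ℝ} (hc : ∀ k, 1 ≤ c k) :
    Continuous fun y : ℝ => ∑' k : ℕ, y ^ k / ((k.factorial : ℝ) * c k) := by
  rw [continuous_iff_continuousAt]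
  intro y
  have h : ContinuousOn (fun y : ℝ => ∑' k : ℕ, y ^ k / ((k.factorial : ℝ) * c k))
      (Metric.ball 0 (|y| + 1)) :=
    continuousOn_tsum (fun k => by fun_prop) (Real.summable_pow_div_factorial (|y| + 1))
      fun k x hx => abs_pow_div_factorial_mul_le x
        (by simpa using (mem_ball_zero_iff.mp hx).le) (hc k) k
  exact h.continuousAt (Metric.isOpen_ball.mem_nhds (by simp))

theorem summable_pow_div_factorial_mul {c : ℕ → ℝ} (hc : ∀ k, 1 ≤ c k) (y : ℝ) :
    Summable fun k : ℕ => y ^ k / ((k.factorial : ℝ) * c k) :=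
  Summable.of_norm_bounded (Real.summable_pow_div_factorial |y|)
    fun k => abs_pow_div_factorial_mul_le y le_rfl (hc k) k

theorem one_le_cast_factorial (k : ℕ) : (1 : ℝ) ≤ k.factorial :=
  mod_cast Nat.one_le_iff_ne_zero.mpr k.factorial_ne_zero

theorem continuous_besselSum0 : Continuous besselSum0 := by
  have h := continuous_tsum_pow_div_factorial_mul one_le_cast_factorial
  simp only [← sq] at h
  exact h

theorem continuous_besselSum1 : Continuous besselSum1 :=
  continuous_tsum_pow_div_factorial_mul fun k => one_le_cast_factorial (k + 1)

theorem hasSum_besselSum0 (y : ℝ) :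
    HasSum (fun k : ℕ => y ^ k / (k.factorial : ℝ) ^ 2) (besselSum0 y) := by
  have h := summable_pow_div_factorial_mul one_le_cast_factorial y
  simp only [← sq] at h
  exact h.hasSum

theorem hasSum_besselSum1 (y : ℝ) :
    HasSum (fun k : ℕ => y ^ k / ((k.factorial : ℝ) * ((k + 1).factorial : ℝ))) (besselSum1 y) :=
  (summable_pow_div_factorial_mul (fun k => one_le_cast_factorial (k + 1)) y).hasSum

theorem besselSum0_nonneg {y : ℝ} (hy : 0 ≤ y) : 0 ≤ besselSum0 y :=
  tsum_nonneg fun k => by positivity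

theorem besselSum1_nonneg {y : ℝ} (hy : 0 ≤ y) : 0 ≤ besselSum1 y :=
  tsum_nonneg fun k => by positivity

/-- `e^{λ h}` times the density of the occupation time of the initial state, on the event of an odd
number of jumps before `h`. -/
def oddKernel (l h u : ℝ) : ℝ := l * besselSum0 (l ^ 2 * (u * (h - u)))

/-- `e^{λ h}` times the density of the occupation time of the initial state, on the event of an even
and positive number of jumps before `h`. -/
def evenKernel (l h u : ℝ) : ℝ := l ^ 2 * u * besselSum1 (l ^ 2 * (u * (h - u)))

theorem continuous_oddKernel (l h : ℝ) : Continuous (oddKernel l h) :=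
  continuous_const.mul (continuous_besselSum0.comp (by fun_prop))

theorem continuous_evenKernel (l h : ℝ) : Continuous (evenKernel l h) :=
  (continuous_const.mul continuous_id).mul (continuous_besselSum1.comp (by fun_prop))

theorem oddKernel_nonneg {l h u : ℝ} (hl : 0 ≤ l) (hu : u ∈ Icc 0 h) : 0 ≤ oddKernel l h u :=
  mul_nonneg hl (besselSum0_nonneg (mul_nonneg (sq_nonneg l)
    (mul_nonneg hu.1 (sub_nonneg.mpr hu.2))))

theorem evenKernel_nonneg {l h u : ℝ} (hu : u ∈ Icc 0 h) : 0 ≤ evenKernel l h u :=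
  mul_nonneg (mul_nonneg (sq_nonneg l) hu.1) (besselSum1_nonneg (mul_nonneg (sq_nonneg l)
    (mul_nonneg hu.1 (sub_nonneg.mpr hu.2))))

/-- Expanding the Bessel series under the integral gives exactly the convolutions `expConv θ k k`;
dominated convergence justifies the exchange. -/
theorem integral_exp_mul_oddKernel (θ l h : ℝ) :
    ∫ u in (0 : ℝ)..h, Real.exp (θ * u) * oddKernel l h u = oddSeries θ l h := by
  have key := intervalIntegral.hasSum_integral_of_dominated_convergence (a := 0) (b := h)
    (μ := volume)
    (F := fun (k : ℕ) u => l ^ (2 * k + 1) * (expMonomial θ k u * ((h - u) ^ k / k.factorial)))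
    (f := fun u => Real.exp (θ * u) * oddKernel l h u)
    (fun k _ => |l| * (Real.exp (|θ| * |h|) * Real.exp |h|)
      * (|l| ^ (2 * k) * (|h| ^ k / k.factorial)))
    (fun k => ((continuous_expMonomial θ k).mul (by fun_prop)).const_mul _
      |>.aestronglyMeasurable)
    (fun k => .of_forall fun u hu => by
      rw [norm_mul, norm_pow, Real.norm_eq_abs, Real.norm_eq_abs]
      calc _ ≤ |l| ^ (2 * k + 1) * (|h| ^ k / k.factorial
            * (Real.exp (|θ| * |h|) * Real.exp |h|)) := by
            gcongr; exact abs_expMonomial_mul_le θ k k le_rfl hu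
        _ = _ := by ring)
    (.of_forall fun _ _ => (summable_pow_mul_pow_div_factorial l |h|).mul_left _)
    (by simp)
    (.of_forall fun u _ => by
      have h := ((hasSum_besselSum0 (l ^ 2 * (u * (h - u)))).mul_left l).mul_left
        (Real.exp (θ * u))
      refine h.congr_fun fun k => ?_
      simp only [expMonomial, mul_pow]
      field_simp
      ring)
  rw [← key.tsum_eq, oddSeries]
  exact tsum_congr fun k => by rw [intervalIntegral.integral_const_mul, expConv_eq]

theorem integral_exp_mul_evenKernel (θ l h : ℝ) :
    Real.exp (θ * h) + ∫ u in (0 : ℝ)..h, Real.exp (θ * u) * evenKernel l h u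
      = evenSeries θ l h := by
  have key := intervalIntegral.hasSum_integral_of_dominated_convergence (a := 0) (b := h)
    (μ := volume)
    (F := fun (k : ℕ) u =>
      l ^ (2 * k + 2) * (expMonomial θ (k + 1) u * ((h - u) ^ k / k.factorial)))
    (f := fun u => Real.exp (θ * u) * evenKernel l h u)
    (fun k _ => (Real.exp (|θ| * |h|) * Real.exp |h|)
      * (|l| ^ (2 * k + 2) * (|h| ^ (k + 1) / (k + 1).factorial)))
    (fun k => ((continuous_expMonomial θ (k + 1)).mul (by fun_prop)).const_mul _
      |>.aestronglyMeasurable)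
    (fun k => .of_forall fun u hu => by
      rw [norm_mul, norm_pow, Real.norm_eq_abs, Real.norm_eq_abs]
      calc _ ≤ |l| ^ (2 * k + 2) * (|h| ^ (k + 1) / (k + 1).factorial
            * (Real.exp (|θ| * |h|) * Real.exp |h|)) := by
            gcongr; exact abs_expMonomial_mul_le θ (k + 1) k le_rfl hu
        _ = _ := by ring)
    (.of_forall fun _ _ => (summable_pow_mul_pow_succ_div_factorial l |h|).mul_left _)
    (by simp)
    (.of_forall fun u _ => by
      have h := ((hasSum_besselSum1 (l ^ 2 * (u * (h - u)))).mul_left (l ^ 2 * u)).mul_left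
        (Real.exp (θ * u))
      refine h.congr_fun fun k => ?_
      simp only [expMonomial, mul_pow]
      field_simp
      ring)
  rw [evenSeries, ← key.tsum_eq]
  congr 1
  exact tsum_congr fun k => by rw [intervalIntegral.integral_const_mul, expConv_eq]

open TelegraphFilter in
theorem qMinus_eq (l h u : ℝ) (hu : u ∈ Icc 0 h) :
    qMinus h l (2 * u - h) = oddKernel l h u / 2 := by
  have h1 : 0 ≤ h ^ 2 - (2 * u - h) ^ 2 := by nlinarith [hu.1, hu.2]
  have h2 : (√(h ^ 2 - (2 * u - h) ^ 2) * l) ^ 2 / 4 = l ^ 2 * (u * (h - u)) := by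
    rw [mul_pow, Real.sq_sqrt h1]; ring
  rw [qMinus, besselB0, h2, oddKernel, besselSum0]
  ring

open TelegraphFilter in
-- The substitution `x = 2u - h` gives `h² - x² = 4u(h - u)`, and the square-root quotient times
-- `√(h² - x²)` is `2u`. The point `u = h` is excluded: there the quotient divides by zero and takes
-- the default value `0`, so the left side vanishes while the kernel need not.
theorem qPlus_eq (l h u : ℝ) (hu : u ∈ Ico 0 h) :
    qPlus h l (2 * u - h) = evenKernel l h u / 2 := by
  have h1 : 0 ≤ h ^ 2 - (2 * u - h) ^ 2 := by nlinarith [hu.1, hu.2]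
  have h2 : (√(h ^ 2 - (2 * u - h) ^ 2) * l) ^ 2 / 4 = l ^ 2 * (u * (h - u)) := by
    rw [mul_pow, Real.sq_sqrt h1]; ring
  have h3 : √((h + (2 * u - h)) / (h - (2 * u - h))) * √(h ^ 2 - (2 * u - h) ^ 2) = 2 * u := by
    have h4 : h - u ≠ 0 := by linarith [hu.2]
    rw [← Real.sqrt_mul (div_nonneg (by linarith [hu.1]) (by linarith [hu.2])),
      show (h + (2 * u - h)) / (h - (2 * u - h)) * (h ^ 2 - (2 * u - h) ^ 2) = (2 * u) ^ 2 by
        rw [show h - (2 * u - h) = 2 * (h - u) by ring]; field_simp; ring,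
      Real.sqrt_sq (by linarith [hu.1])]
  rw [qPlus, besselB1, h2, evenKernel, besselSum1]
  linear_combination (l ^ 2 / 4 * ∑' k : ℕ, (l ^ 2 * (u * (h - u))) ^ k /
    ((k.factorial : ℝ) * ((k + 1).factorial : ℝ))) * h3

open TelegraphFilter in
theorem qTotal_eq (l h x : ℝ) : qTotal h l x = qMinus h l x + qPlus h l x := by
  rw [qTotal, qMinus, qPlus, mul_comm l √_]
  ring

end BesselKernels

/-! ### Matrix powers as sums over paths -/

section PathSums

theorem sum_path_prod_eq_pow_apply {d : ℕ} (B : Matrix (Fin d) (Fin d) ℝ) (n : ℕ) (i j : Fin d) :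
    ∑ x : Fin (n + 1) → Fin d, (if x 0 = i ∧ x (Fin.last n) = j then
      ∏ k : Fin n, B (x k.castSucc) (x k.succ) else 0) = (B ^ n) i j := by
  induction n generalizing i with
  | zero =>
    rw [← (Equiv.funUnique (Fin 1) (Fin d)).symm.sum_comp]
    simp only [Equiv.funUnique_symm_apply, uniqueElim_const, Finset.univ_eq_empty,
      Finset.prod_empty, pow_zero, Matrix.one_apply]
    rw [Finset.sum_eq_single i] <;> grind
  | succ n ih =>
    rw [← (Fin.consEquiv fun _ => Fin d).sum_comp, Fintype.sum_prod_type, pow_succ',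
      Matrix.mul_apply, Finset.sum_comm]
    simp_rw [← ih, Finset.mul_sum]
    conv_rhs => rw [Finset.sum_comm]
    refine Finset.sum_congr rfl fun y _ => ?_
    have hl : ∀ a : Fin d, (Fin.consEquiv fun _ => Fin d) (a, y) (Fin.last (n + 1))
        = y (Fin.last n) := fun a => rfl
    have h0 : ∀ a : Fin d, (Fin.consEquiv fun _ => Fin d) (a, y) 0 = a := fun a => rfl
    have hs : ∀ (a : Fin d) (k : Fin (n + 1)),
        (Fin.consEquiv fun _ => Fin d) (a, y) k.succ = y k := fun a k => rfl
    simp only [hl, h0]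
    rw [Finset.sum_eq_single i (fun a _ ha => by simp [ha]) (by simp),
      Finset.sum_eq_single (y 0) (fun a _ ha => by simp [Ne.symm ha]) (by simp)]
    simp only [true_and, Fin.prod_univ_succ (n := n), hs, Fin.castSucc_zero, h0]
    split_ifs with h
    · congr 1
    · simp

end PathSums

/-! ### Riemann sums of right-continuous paths -/

section RiemannSums

/-- The Riemann sum over `[0, h]` at the right end points of `n + 1` intervals of equal length. -/
def rightRiemannSum (f : ℝ≥0 → ℝ) (h : ℝ≥0) (n : ℕ) : ℝ :=
  ∑ k ∈ Finset.range (n + 1), (h / (n + 1) : ℝ) * f ((k + 1) * (h / (n + 1)))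

theorem grid_le (h : ℝ≥0) {n k : ℕ} (hk : k ≤ n + 1) : (k : ℝ≥0) * (h / (n + 1)) ≤ h := by
  have hk' : (k : ℝ≥0) ≤ n + 1 := by exact_mod_cast hk
  calc (k : ℝ≥0) * (h / (n + 1)) ≤ (n + 1) * (h / (n + 1)) := by gcongr
    _ = h := by field_simp

theorem rightRiemannSum_congr {f g : ℝ≥0 → ℝ} {h : ℝ≥0} (hfg : ∀ t ≤ h, f t = g t) (n : ℕ) :
    rightRiemannSum f h n = rightRiemannSum g h n := by
  refine Finset.sum_congr rfl fun k hk => ?_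
  rw [hfg]
  simpa using grid_le h (n := n) (k := k + 1) (by simpa using hk)

theorem rightRiemannSum_add_mul (a b : ℝ) (f : ℝ≥0 → ℝ) (h : ℝ≥0) (n : ℕ) :
    rightRiemannSum (fun t => a + b * f t) h n = a * h + b * rightRiemannSum f h n := by
  simp only [rightRiemannSum, mul_add, Finset.sum_add_distrib, Finset.mul_sum]
  congr 1
  · rw [Finset.sum_const, Finset.card_range, nsmul_eq_mul]
    push_cast
    field_simp
  · exact Finset.sum_congr rfl fun k _ => by ring

theorem rightRiemannSum_mem_Icc {f : ℝ≥0 → ℝ} (hf : ∀ t, f t ∈ Icc 0 1) (h : ℝ≥0) (n : ℕ) :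
    rightRiemannSum f h n ∈ Icc 0 (h : ℝ) := by
  refine ⟨Finset.sum_nonneg fun k _ => mul_nonneg (by positivity) (hf _).1, ?_⟩
  calc rightRiemannSum f h n ≤ ∑ k ∈ Finset.range (n + 1), (h / (n + 1) : ℝ) * 1 := by
        unfold rightRiemannSum
        gcongr
        exact (hf _).2
    _ = h := by simp; field_simp

/-- The sum is the integral of a step function that samples `f` at the next grid point at or after
`s`. These points approach `s` from the right, so right-continuity gives pointwise convergence, and
boundedness gives convergence of the integrals. -/
theorem tendsto_rightRiemannSum {f : ℝ≥0 → ℝ} {h : ℝ≥0} (hh : 0 < h) {M : ℝ}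
    (hM : ∀ t, |f t| ≤ M) (hf : ∀ t < h, ContinuousWithinAt f (Ici t) t) :
    Tendsto (rightRiemannSum f h) atTop (𝓝 (∫ s in (0 : ℝ)..h, f s.toNNReal)) := by
  have hh' : (0 : ℝ) < h := hh
  set Δ : ℕ → ℝ := fun n => h / (n + 1) with hΔ
  have hΔpos : ∀ n, 0 < Δ n := fun n => by positivity
  set F : ℕ → ℝ → ℝ := fun n s => f (((⌈s / Δ n⌉₊ : ℝ) * Δ n).toNNReal) with hF
  have hmeas : ∀ n, Measurable (F n) := fun n =>
    (Measurable.of_discrete (f := fun m : ℕ => f (((m : ℝ) * Δ n).toNNReal))).comp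
      (Nat.measurable_ceil.comp (measurable_id.div_const _))
  have hint : ∀ n a b, IntervalIntegrable (F n) volume a b := fun n a b =>
    (intervalIntegrable_const (c := M)).mono_fun (hmeas n).aestronglyMeasurable
      (.of_forall fun s => (hM _).trans (le_abs_self M))
  have hsum : ∀ n, rightRiemannSum f h n = ∫ s in (0 : ℝ)..h, F n s := by
    intro n
    have h1 := intervalIntegral.sum_integral_adjacent_intervals (f := F n) (μ := volume)
      (a := fun k : ℕ => (k : ℝ) * Δ n) (n := n + 1) fun k _ => hint n _ _
    have h2 : ((n + 1 : ℕ) : ℝ) * Δ n = h := by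
      simp only [hΔ]; push_cast; field_simp
    rw [h2] at h1
    simp only [Nat.cast_zero, zero_mul] at h1
    rw [← h1]
    refine Finset.sum_congr rfl fun k _ => ?_
    have hle : (k : ℝ) * Δ n ≤ ((k + 1 : ℕ) : ℝ) * Δ n := by
      push_cast; nlinarith [hΔpos n]
    have h3 : ∫ s in (k : ℝ) * Δ n..((k + 1 : ℕ) : ℝ) * Δ n, F n s
        = ∫ _ in (k : ℝ) * Δ n..((k + 1 : ℕ) : ℝ) * Δ n, f ((k + 1) * (h / (n + 1))) := by
      rw [intervalIntegral.integral_of_le hle, intervalIntegral.integral_of_le hle]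
      refine setIntegral_congr_fun measurableSet_Ioc fun s hs => ?_
      have hc : ⌈s / Δ n⌉₊ = k + 1 := by
        rw [Nat.ceil_eq_iff (by simp)]
        constructor
        · rw [lt_div_iff₀ (hΔpos n)]; simpa using hs.1
        · rw [div_le_iff₀ (hΔpos n)]; exact hs.2
      simp only [hF, hc]
      congr 1
      ext
      rw [Real.coe_toNNReal _ (by have := hΔpos n; positivity)]
      simp [hΔ]
    rw [h3, intervalIntegral.integral_const, smul_eq_mul]
    push_cast
    ring
  rw [show rightRiemannSum f h = fun n => ∫ s in (0 : ℝ)..h, F n s from funext hsum]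
  refine intervalIntegral.tendsto_integral_filter_of_dominated_convergence (fun _ => M)
    (.of_forall fun n => (hmeas n).aestronglyMeasurable)
    (.of_forall fun n => .of_forall fun s _ => hM _) intervalIntegrable_const ?_
  -- Right-continuity is assumed only before `h`; the end point is a null set.
  have hne : ∀ᵐ s : ℝ, s ≠ h := by
    simp [ae_iff]
  filter_upwards [hne] with s hs hs'
  rw [uIoc_of_le hh'.le] at hs'
  have hsh : s < h := lt_of_le_of_ne hs'.2 hs
  have hst : s.toNNReal < h := by
    rw [← NNReal.coe_lt_coe, Real.coe_toNNReal _ hs'.1.le]; exact hsh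
  refine (hf _ hst).tendsto.comp (tendsto_nhdsWithin_iff.mpr ⟨?_, .of_forall fun n => ?_⟩)
  · refine (continuous_real_toNNReal.tendsto s).comp ?_
    have hlim : Tendsto (fun n : ℕ => s + Δ n) atTop (𝓝 s) := by
      have := tendsto_one_div_add_atTop_nhds_zero_nat (𝕜 := ℝ)
      simpa [hΔ, div_eq_mul_inv] using (this.const_mul (h : ℝ)).const_add s
    refine tendsto_of_tendsto_of_tendsto_of_le_of_le tendsto_const_nhds hlim
      (fun n => ?_) fun n => ?_
    · have := Nat.le_ceil (s / Δ n)
      rwa [div_le_iff₀ (hΔpos n)] at this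
    · have := Nat.ceil_lt_add_one (div_nonneg hs'.1.le (hΔpos n).le)
      rw [← sub_lt_iff_lt_add, lt_div_iff₀ (hΔpos n)] at this
      simp only
      linarith
  · refine Real.toNNReal_le_toNNReal ?_
    have := Nat.le_ceil (s / Δ n)
    rwa [div_le_iff₀ (hΔpos n)] at this

end RiemannSums

/-! ### Laplace transform of the occupation time -/

section OccupationTime

open TelegraphFilter

variable {Ω : Type*} [MeasurableSpace Ω] {P : Measure Ω} [IsProbabilityMeasure P]

/-- A discrete Feynman-Kac formula: weighting each arrival state by `w` multiplies every transition
matrix on the right by `diag w`, and summing over grid paths gives a matrix power. The weight sits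
at right end points, so the initial state is unweighted. -/
theorem TelegraphFilter.IsMarkovChainOn.integral_prod {d : ℕ} {Q : Matrix (Fin d) (Fin d) ℝ} {p₀ : Fin d → ℝ}
    {T : ℝ≥0} {ε : ℝ≥0 → Ω → Fin d} (hε : IsMarkovChainOn Q p₀ T ε P) {h : ℝ≥0} (hT : h ≤ T)
    (w : Fin d → ℝ) (n : ℕ) (i j : Fin d) :
    ∫ ω in {ω | ε 0 ω = i ∧ ε h ω = j},
        ∏ k ∈ Finset.range (n + 1), w (ε ((k + 1) * (h / (n + 1))) ω) ∂P
      = p₀ i * ((NormedSpace.exp ((h / (n + 1) : ℝ) • Q) * Matrix.diagonal w) ^ (n + 1)) i j := by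
  set t : Fin (n + 1 + 1) → ℝ≥0 := fun k => (k : ℕ) * (h / (n + 1)) with ht
  have hle : ∀ k, t k ≤ h := fun k => grid_le h (by omega)
  have htl : t (Fin.last (n + 1)) = h := by
    simp only [ht, Fin.val_last]; push_cast; field_simp
  have ht0 : t 0 = 0 := by simp [ht]
  have hmono : Monotone t := fun a b hab => by
    have : ((a : ℕ) : ℝ≥0) ≤ (b : ℕ) := by exact_mod_cast hab
    simp only [ht]; gcongr
  set V : Ω → Fin (n + 1 + 1) → Fin d := fun ω k => ε (t k) ω with hV
  have hVm : Measurable V := measurable_pi_lambda _ fun k => hε.measurable _ ((hle k).trans hT)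
  have hA : MeasurableSet {ω | ε 0 ω = i ∧ ε h ω = j} :=
    (hε.measurable 0 zero_le (measurableSet_singleton i)).inter
      (hε.measurable h hT (measurableSet_singleton j))
  have hfd : ∀ x, P.real {ω | V ω = x} =
      p₀ (x 0) * ∏ k : Fin (n + 1),
        NormedSpace.exp ((h / (n + 1) : ℝ) • Q) (x k.castSucc) (x k.succ) := by
    intro x
    have h1 := hε.finiteDimensional (n + 1) t hmono ht0 (htl.le.trans hT) x
    have h2 : ∀ k : Fin (n + 1), ((t k.succ : ℝ) - t k.castSucc) = h / (n + 1) := by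
      intro k
      simp only [ht, Fin.val_succ, Fin.val_castSucc]
      push_cast
      ring
    simp only [h2] at h1
    rw [← h1]
    congr 1
    ext ω
    simp [hV, funext_iff]
  set G : (Fin (n + 1 + 1) → Fin d) → ℝ := fun x =>
    if x 0 = i ∧ x (Fin.last (n + 1)) = j then ∏ k : Fin (n + 1), w (x k.succ) else 0 with hG
  have hGV : ({ω | ε 0 ω = i ∧ ε h ω = j}.indicator
      fun ω => ∏ k ∈ Finset.range (n + 1), w (ε ((k + 1) * (h / (n + 1))) ω))
      = fun ω => G (V ω) := by
    ext ω
    simp only [hG, hV, indicator_apply, mem_ofPred_eq, ht0, htl, Finset.prod_range]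
    congr 1
    refine Finset.prod_congr rfl fun k _ => ?_
    simp [ht]
  rw [← integral_indicator hA, hGV, ← integral_map (f := G) hVm.aemeasurable
    (Measurable.of_discrete.aestronglyMeasurable), integral_fintype (Integrable.of_finite),
    ← sum_path_prod_eq_pow_apply, Finset.mul_sum]
  refine Finset.sum_congr rfl fun x _ => ?_
  rw [map_measureReal_apply hVm (measurableSet_singleton x)]
  change P.real {ω | V ω = x} • _ = _
  rw [hfd, hG]
  simp only [Matrix.mul_diagonal, Finset.prod_mul_distrib, smul_eq_mul]
  split_ifs with hx
  · rw [hx.1]; ring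
  · simp

theorem exp_smul_occupationMatrix (θ t : ℝ) (i : Fin 2) :
    NormedSpace.exp (t • occupationMatrix θ i)
      = Matrix.diagonal fun k => Real.exp (θ * (t * if k = i then 1 else 0)) := by
  rw [occupationMatrix, ← Matrix.diagonal_smul, Matrix.exp_diagonal]
  congr 1
  ext k
  rw [Pi.coe_exp, ← Real.exp_eq_exp_ℝ]
  congr 1
  simp only [Pi.smul_apply, smul_eq_mul]
  split_ifs <;> ring

open scoped Matrix.Norms.Operator in
-- Lie-Trotter: the product of the two exponentials has derivative `h (Q + D)` at `0`, so the
-- Chernoff limit applies.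
theorem tendsto_exp_mul_diagonal_pow (Q : Matrix (Fin 2) (Fin 2) ℝ) (h θ : ℝ) (i : Fin 2) :
    Tendsto (fun n : ℕ => (NormedSpace.exp ((h / (n + 1) : ℝ) • Q) *
        Matrix.diagonal fun k => Real.exp (θ * (h / (n + 1) * if k = i then 1 else 0))) ^ (n + 1))
      atTop (𝓝 (NormedSpace.exp (h • (Q + occupationMatrix θ i)))) := by
  have h1 := hasDerivAt_exp_smul_const (𝕂 := ℝ) (h • Q) 0
  have h2 := hasDerivAt_exp_smul_const (𝕂 := ℝ) (h • occupationMatrix θ i) 0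
  have h3 := h1.mul h2
  simp only [zero_smul, NormedSpace.exp_zero, one_mul, mul_one] at h3
  have h4 := h3.tendsto_inv_pow_exp (by simp [NormedSpace.exp_zero])
  rw [← smul_add] at h4
  refine h4.congr fun n => ?_
  simp only [Pi.mul_apply]
  congr 2
  · rw [smul_smul]; congr 2; ring
  · rw [smul_smul]
    refine (exp_smul_occupationMatrix θ _ i).trans ?_
    have e : 1 / ((n : ℝ) + 1) * h = h / (n + 1) := by ring
    rw [e]

/-- The indicator function of the times at which the path `x` is in state `i`. -/
def stateIndicator {d : ℕ} (i : Fin d) (x : ℝ≥0 → Fin d) (t : ℝ≥0) : ℝ := if x t = i then 1 else 0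

theorem stateIndicator_mem_Icc {d : ℕ} (i : Fin d) (x : ℝ≥0 → Fin d) (t : ℝ≥0) :
    stateIndicator i x t ∈ Icc 0 1 := by
  unfold stateIndicator; split_ifs <;> simp

/-- The time that the path `x` spends in state `i` before time `h`, as a limit of Riemann sums. -/
def occupationTime {d : ℕ} (i : Fin d) (h : ℝ≥0) (x : ℝ≥0 → Fin d) : ℝ :=
  limsup (rightRiemannSum (stateIndicator i x) h) atTop

theorem tendsto_occupationTime {d : ℕ} (i : Fin d) {h : ℝ≥0} (hh : 0 < h) {x : ℝ≥0 → Fin d}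
    (hx : ∀ t < h, ContinuousWithinAt x (Ici t) t) :
    Tendsto (rightRiemannSum (stateIndicator i x) h) atTop (𝓝 (occupationTime i h x)) := by
  have h1 : Tendsto (rightRiemannSum (stateIndicator i x) h) atTop _ :=
    tendsto_rightRiemannSum hh (M := 1)
      (fun t => by rw [abs_le]; have := stateIndicator_mem_Icc i x t; constructor <;>
        linarith [this.1, this.2])
      (fun t ht => (continuous_of_discreteTopology (f := fun k : Fin d =>
        if k = i then (1 : ℝ) else 0)).continuousAt.comp_continuousWithinAt (hx t ht))
  rwa [occupationTime, h1.limsup_eq]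

theorem occupationTime_mem_Icc {d : ℕ} (i : Fin d) {h : ℝ≥0} (hh : 0 < h) {x : ℝ≥0 → Fin d}
    (hx : ∀ t < h, ContinuousWithinAt x (Ici t) t) : occupationTime i h x ∈ Icc 0 (h : ℝ) :=
  isClosed_Icc.mem_of_tendsto (tendsto_occupationTime i hh hx)
    (.of_forall fun n => rightRiemannSum_mem_Icc (stateIndicator_mem_Icc i x) h n)

theorem integral_eq_occupationTime (α : Fin 2 → ℝ) {i j : Fin 2} (hij : j ≠ i) {h : ℝ≥0}
    (hh : 0 < h) {x : ℝ≥0 → Fin 2} (hx : ∀ t < h, ContinuousWithinAt x (Ici t) t) :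
    ∫ s in (0 : ℝ)..h, α (x s.toNNReal) = α j * h + (α i - α j) * occupationTime i h x := by
  have h1 : Tendsto (rightRiemannSum (fun t => α (x t)) h) atTop
      (𝓝 (∫ s in (0 : ℝ)..h, α (x s.toNNReal))) :=
    tendsto_rightRiemannSum hh (M := ∑ k, |α k|)
      (fun t => Finset.single_le_sum (f := fun k => |α k|) (fun _ _ => abs_nonneg _)
        (Finset.mem_univ (x t)))
      (fun t ht => (continuous_of_discreteTopology
        (f := α)).continuousAt.comp_continuousWithinAt (hx t ht))
  refine tendsto_nhds_unique h1 ?_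
  have h2 : (fun t => α (x t)) = fun t => α j + (α i - α j) * stateIndicator i x t := by
    ext t
    simp only [stateIndicator]
    have : x t = i ∨ x t = j := by omega
    rcases this with h | h <;> simp [h, hij]
  rw [h2]
  refine (((tendsto_occupationTime i hh hx).const_mul (α i - α j)).const_add (α j * h)).congr
    fun n => (rightRiemannSum_add_mul _ _ _ h n).symm

/-- Only countably many times enter the Riemann sums, so their `limsup` is measurable for the
product σ-algebra on paths. This makes the occupation time a measurable function of the path, as the
use of independence requires. -/
theorem measurable_occupationTime {E : Type*} [MeasurableSpace E] {d : ℕ} (i : Fin d) (h : ℝ≥0)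
    {x : ℝ≥0 → E → Fin d} (hx : ∀ t ≤ h, Measurable (x t)) :
    Measurable fun e => occupationTime i h fun t => x t e := by
  refine Measurable.limsup fun n => Finset.measurable_fun_sum _ fun k hk => ?_
  refine Measurable.const_mul ((Measurable.of_discrete (f := fun k : Fin d =>
    if k = i then (1 : ℝ) else 0)).comp (hx _ ?_)) _
  simpa using grid_le h (n := n) (k := k + 1) (by simpa using hk)

theorem setIntegral_exp_occupationTime {l : ℝ} {p₀ : Fin 2 → ℝ} {T : ℝ≥0}
    {ε : ℝ≥0 → Ω → Fin 2} (hε : IsMarkovChainOn (symmetricQ l) p₀ T ε P) {h : ℝ≥0} (hh : 0 < h)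
    (hT : h ≤ T) (θ : ℝ) (i j : Fin 2) :
    ∫ ω in {ω | ε 0 ω = i ∧ ε h ω = j}, Real.exp (θ * occupationTime i h fun t => ε t ω) ∂P
      = p₀ i * Real.exp (-l * h) * if j = i then evenSeries θ l h else oddSeries θ l h := by
  have h1 : Tendsto (fun n => ∫ ω in {ω | ε 0 ω = i ∧ ε h ω = j},
      Real.exp (θ * rightRiemannSum (stateIndicator i fun t => ε t ω) h n) ∂P) atTop
      (𝓝 (∫ ω in {ω | ε 0 ω = i ∧ ε h ω = j},
        Real.exp (θ * occupationTime i h fun t => ε t ω) ∂P)) := by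
    refine tendsto_integral_of_dominated_convergence (fun _ => Real.exp (|θ| * h))
      (fun n => Measurable.aestronglyMeasurable ?_) (integrable_const _)
      (fun n => .of_forall fun ω => ?_) (ae_restrict_of_ae ?_)
    · refine Real.measurable_exp.comp (Measurable.const_mul
        (Finset.measurable_fun_sum _ fun k hk => Measurable.const_mul
          ((Measurable.of_discrete (f := fun k : Fin 2 =>
            if k = i then (1 : ℝ) else 0)).comp (hε.measurable _ ?_)) _) _)
      refine le_trans ?_ hT
      simpa using grid_le h (n := n) (k := k + 1) (by simpa using hk)
    · rw [Real.norm_eq_abs, Real.abs_exp]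
      have h2 := rightRiemannSum_mem_Icc (stateIndicator_mem_Icc i fun t => ε t ω) h n
      refine Real.exp_le_exp.mpr ((le_abs_self _).trans ?_)
      rw [abs_mul, abs_of_nonneg h2.1]
      exact mul_le_mul_of_nonneg_left h2.2 (abs_nonneg _)
    · filter_upwards [hε.rightContinuous] with ω hω
      exact (Real.continuous_exp.tendsto _).comp ((tendsto_occupationTime i hh
        fun t ht => hω t (ht.trans_le hT)).const_mul θ)
  refine tendsto_nhds_unique h1 ?_
  have h2 : ∀ n, ∫ ω in {ω | ε 0 ω = i ∧ ε h ω = j},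
      Real.exp (θ * rightRiemannSum (stateIndicator i fun t => ε t ω) h n) ∂P
      = p₀ i * ((NormedSpace.exp ((h / (n + 1) : ℝ) • symmetricQ l) * Matrix.diagonal
        fun k => Real.exp (θ * (h / (n + 1) * if k = i then 1 else 0))) ^ (n + 1)) i j := by
    intro n
    rw [← hε.integral_prod hT]
    congr with ω
    rw [← Real.exp_sum, rightRiemannSum, Finset.mul_sum]
    rfl
  simp_rw [h2, mul_assoc, ← exp_symmetricQ_add_occupationMatrix]
  have h3 := tendsto_exp_mul_diagonal_pow (symmetricQ l) h θ i
  exact ((continuous_apply_apply i j).tendsto _ |>.comp h3).const_mul (p₀ i)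

end OccupationTime

/-! ### From Laplace transforms to laws -/

section LawOfOccupationTime

/-- Moment generating functions that are finite everywhere extend analytically to the whole complex
plane, so equality on the real line forces equality of the characteristic functions. -/
theorem measure_eq_of_integral_exp_eq {μ ν : Measure ℝ} [IsFiniteMeasure μ] [IsFiniteMeasure ν]
    (hint : ∀ θ : ℝ, Integrable (fun x => Real.exp (θ * x)) μ)
    (heq : ∀ θ : ℝ, ∫ x, Real.exp (θ * x) ∂μ = ∫ x, Real.exp (θ * x) ∂ν) : μ = ν := by
  refine Measure.ext_of_complexMGF_id_eq ?_
  have hmass : μ.real univ = ν.real univ := by simpa using heq 0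
  have hset : integrableExpSet id μ = univ := eq_univ_of_forall hint
  have hzero : μ = 0 ↔ ν = 0 := by
    rw [← Measure.measure_univ_eq_zero, ← measureReal_eq_zero_iff, hmass,
      measureReal_eq_zero_iff, Measure.measure_univ_eq_zero]
  ext z
  exact eqOn_complexMGF_of_mgf' (X := id) (Y := id) (funext heq) hzero (by simp [hset])

/-- The measure with an atom at `h` and a density `κ` on `(0, h]`. -/
def atomAddDensity (C c h : ℝ) (κ : ℝ → ℝ) : Measure ℝ :=
  ENNReal.ofReal C • (ENNReal.ofReal c • Measure.dirac h +
    (volume.restrict (Ioc 0 h)).withDensity fun u => ENNReal.ofReal (κ u))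

variable {C c h : ℝ} {κ : ℝ → ℝ}

theorem integral_mul_nonneg_of_Icc (hh : 0 ≤ h) (hκ0 : ∀ u ∈ Icc 0 h, 0 ≤ κ u) {g : ℝ → ℝ}
    (hg0 : ∀ u, 0 ≤ g u) : 0 ≤ ∫ u in (0 : ℝ)..h, g u * κ u :=
  intervalIntegral.integral_nonneg hh fun u hu => mul_nonneg (hg0 u) (hκ0 u hu)

/-- Used with two test functions: exponentials, to identify the measure, and a translated Gaussian
density, to convolve it. -/
theorem lintegral_atomAddDensity (hC : 0 ≤ C) (hc : 0 ≤ c) (hh : 0 ≤ h) (hκ : Continuous κ)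
    (hκ0 : ∀ u ∈ Icc 0 h, 0 ≤ κ u) {g : ℝ → ℝ} (hg : Continuous g) (hg0 : ∀ u, 0 ≤ g u) :
    ∫⁻ u, ENNReal.ofReal (g u) ∂atomAddDensity C c h κ
      = ENNReal.ofReal (C * (c * g h + ∫ u in (0 : ℝ)..h, g u * κ u)) := by
  have hgm : Measurable fun u => ENNReal.ofReal (g u) := hg.measurable.ennreal_ofReal
  rw [atomAddDensity, lintegral_smul_measure, lintegral_add_measure, lintegral_smul_measure,
    lintegral_dirac' _ hgm, lintegral_withDensity_eq_lintegral_mul _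
      hκ.measurable.ennreal_ofReal hgm, ENNReal.ofReal_mul hC,
    ENNReal.ofReal_add (mul_nonneg hc (hg0 h)) (integral_mul_nonneg_of_Icc hh hκ0 hg0),
    ENNReal.ofReal_mul hc, intervalIntegral.integral_of_le hh,
    ofReal_integral_eq_lintegral_ofReal (f := fun u => g u * κ u)
      ((hg.mul hκ).integrableOn_Icc.mono_set Ioc_subset_Icc_self)
      (ae_restrict_of_forall_mem measurableSet_Ioc
        fun u hu => mul_nonneg (hg0 u) (hκ0 u (Ioc_subset_Icc_self hu)))]
  simp only [smul_eq_mul, Pi.mul_apply]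
  congr 3
  funext u
  rw [mul_comm, ENNReal.ofReal_mul (hg0 u)]

theorem map_eq_atomAddDensity {Ω : Type*} [MeasurableSpace Ω] {μ : Measure Ω} [IsFiniteMeasure μ]
    {U : Ω → ℝ} (hU : AEMeasurable U μ) (hUb : ∀ᵐ ω ∂μ, U ω ∈ Icc 0 h) (hC : 0 ≤ C) (hc : 0 ≤ c)
    (hh : 0 ≤ h) (hκ : Continuous κ) (hκ0 : ∀ u ∈ Icc 0 h, 0 ≤ κ u)
    (hexp : ∀ θ : ℝ, ∫ ω, Real.exp (θ * U ω) ∂μ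
      = C * (c * Real.exp (θ * h) + ∫ u in (0 : ℝ)..h, Real.exp (θ * u) * κ u)) :
    μ.map U = atomAddDensity C c h κ := by
  have hl := fun θ : ℝ => lintegral_atomAddDensity hC hc hh hκ hκ0
    (g := fun u => Real.exp (θ * u)) (by fun_prop) fun u => (Real.exp_pos _).le
  have : IsFiniteMeasure (atomAddDensity C c h κ) := by
    refine ⟨?_⟩
    have h0 := hl 0
    simp only [zero_mul, Real.exp_zero, ENNReal.ofReal_one, lintegral_one] at h0
    rw [h0]
    exact ENNReal.ofReal_lt_top
  refine measure_eq_of_integral_exp_eq (fun θ => ?_) fun θ => ?_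
  · rw [integrable_map_measure (by fun_prop) hU]
    exact integrable_exp_mul_of_mem_Icc hU hUb
  · rw [integral_map hU (by fun_prop), hexp, integral_eq_lintegral_of_nonneg_ae
      (.of_forall fun u => (Real.exp_pos _).le) (by fun_prop), hl, ENNReal.toReal_ofReal]
    exact mul_nonneg hC (add_nonneg (mul_nonneg hc (Real.exp_pos _).le)
      (integral_mul_nonneg_of_Icc hh hκ0 fun u => (Real.exp_pos _).le))

end LawOfOccupationTime

/-! ### Convolution with the Brownian part -/

section GaussianConvolution

theorem conv_gaussianReal_eq_withDensity (μ : Measure ℝ) [SFinite μ] {v : ℝ≥0} (hv : v ≠ 0) :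
    μ ∗ gaussianReal 0 v = volume.withDensity fun z => ∫⁻ x, gaussianPDF 0 v (z - x) ∂μ := by
  have hm : Measurable fun p : ℝ × ℝ => gaussianPDF 0 v (p.1 - p.2) :=
    (measurable_gaussianPDF 0 v).comp (by fun_prop)
  refine Measure.ext_of_lintegral _ fun f hf => ?_
  rw [Measure.lintegral_conv hf, lintegral_withDensity_eq_lintegral_mul _
    hm.lintegral_prod_right' hf, gaussianReal_of_var_ne_zero 0 hv]
  have h1 : ∀ x, ∫⁻ y, f (x + y) ∂volume.withDensity (gaussianPDF 0 v)
      = ∫⁻ z, gaussianPDF 0 v (z - x) * f z := by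
    intro x
    rw [lintegral_withDensity_eq_lintegral_mul _ (measurable_gaussianPDF 0 v) (by fun_prop),
      ← lintegral_sub_right_eq_self _ x]
    simp
  have h2 : ∀ z, ((fun z => ∫⁻ x, gaussianPDF 0 v (z - x) ∂μ) * f) z
      = ∫⁻ x, gaussianPDF 0 v (z - x) * f z ∂μ := by
    intro z
    rw [lintegral_mul_const]
    · rfl
    · exact (measurable_gaussianPDF 0 v).comp (by fun_prop)
  have hm' : Measurable fun q : ℝ × ℝ => gaussianPDF 0 v (q.2 - q.1) * f q.2 :=
    ((measurable_gaussianPDF 0 v).comp (by fun_prop)).mul (hf.comp measurable_snd)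
  simp_rw [h1, h2]
  exact lintegral_lintegral_swap hm'.aemeasurable

variable {Ω E : Type*} [MeasurableSpace Ω] [MeasurableSpace E] {P : Measure Ω}

/-- The event is determined by `X`, so restricting to it leaves the joint law a product measure and
does not affect the law of `V`. -/
theorem map_restrict_add_eq_conv [IsFiniteMeasure P] {X : Ω → E} {V : Ω → ℝ} (hX : Measurable X)
    (hV : AEMeasurable V P) (hind : IndepFun X V P) {f : E → ℝ} (hf : Measurable f) {A : Set E}
    (hA : MeasurableSet A) :
    (P.restrict (X ⁻¹' A)).map (fun ω => f (X ω) + V ω)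
      = (P.restrict (X ⁻¹' A)).map (fun ω => f (X ω)) ∗ P.map V := by
  have h1 := (indepFun_iff_map_prod_eq_prod_map_map hX.aemeasurable hV).mp hind
  have hXV : AEMeasurable (fun ω => (X ω, V ω)) P := hX.aemeasurable.prodMk hV
  have h2 : (P.restrict (X ⁻¹' A)).map (fun ω => (X ω, V ω))
      = ((P.map X).restrict A).prod (P.map V) := by
    rw [← Measure.restrict_univ (μ := P.map V), Measure.prod_restrict, ← h1,
      Measure.restrict_map_of_aemeasurable hXV (hA.prod MeasurableSet.univ)]
    congr 2
    ext ω
    simp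
  have h3 : (P.restrict (X ⁻¹' A)).map (fun ω => f (X ω)) = ((P.map X).restrict A).map f := by
    rw [Measure.restrict_map hX hA, Measure.map_map hf hX]
    rfl
  have h4 := Measure.map_prod_map ((P.map X).restrict A) (P.map V) hf measurable_id
  rw [Measure.map_id, ← h2] at h4
  rw [h3, Measure.conv, h4, Measure.map_map (by fun_prop) (by fun_prop),
    AEMeasurable.map_map_of_aemeasurable (by fun_prop) hXV.restrict]
  rfl

theorem gaussianPDFReal_eq_phi {σ : ℝ} (hσ : 0 < σ) (h : ℝ≥0) (x : ℝ) :
    gaussianPDFReal 0 (.mk (σ ^ 2) (sq_nonneg _) * h) x = TelegraphFilter.phi (σ * √h) x := by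
  rw [gaussianPDFReal, TelegraphFilter.phi]
  have h1 : (σ * √(h : ℝ)) ^ 2 = σ ^ 2 * h := by rw [mul_pow, Real.sq_sqrt h.coe_nonneg]
  have h2 : ((NNReal.mk (σ ^ 2) (sq_nonneg _) * h : ℝ≥0) : ℝ) = (σ * √(h : ℝ)) ^ 2 := by
    rw [h1]; rfl
  rw [h2, Real.sqrt_mul (by positivity), Real.sqrt_sq (by positivity), one_div]
  congr 2
  rw [sub_zero]
  by_cases h3 : (σ * √(h : ℝ)) ^ 2 = 0
  · simp [h3]
  · field_simp

theorem continuous_phi (s : ℝ) : Continuous (TelegraphFilter.phi s) := by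
  unfold TelegraphFilter.phi; fun_prop

theorem phi_nonneg {s : ℝ} (hs : 0 ≤ s) (x : ℝ) : 0 ≤ TelegraphFilter.phi s x := by
  unfold TelegraphFilter.phi; positivity

/-- The common engine of the three density claims. Here `C` is the factor `p₀(i) e^{-λh}`, `c` is
the weight of the no-jump atom (`1` or `0`), and `C m` is the probability of the event, so that `C`
cancels on conditioning. -/
theorem hasCondDensity_of_integral_exp [IsProbabilityMeasure P] {X : Ω → E} {V Z : Ω → ℝ}
    {f : E → ℝ} {A : Set E} {h : ℝ≥0} {σ C c m p d : ℝ} {κ : ℝ → ℝ} (hh : 0 < h) (hσ : 0 < σ)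
    (hX : Measurable X) (hV : HasLaw V (gaussianReal 0 h) P) (hind : IndepFun X V P)
    (hf : Measurable f) (hfb : ∀ᵐ ω ∂P, f (X ω) ∈ Icc 0 (h : ℝ)) (hA : MeasurableSet A)
    (hZ : ∀ᵐ ω ∂P, Z ω = p + d * f (X ω) + σ * V ω)
    (hC : 0 < C) (hc : 0 ≤ c) (hm : 0 < m) (hκ : Continuous κ) (hκ0 : ∀ u ∈ Icc 0 (h : ℝ), 0 ≤ κ u)
    (hPA : P.real (X ⁻¹' A) = C * m)
    (hexp : ∀ θ : ℝ, ∫ ω in X ⁻¹' A, Real.exp (θ * f (X ω)) ∂P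
      = C * (c * Real.exp (θ * h) + ∫ u in (0 : ℝ)..h, Real.exp (θ * u) * κ u)) :
    TelegraphFilter.HasCondDensity Z P (X ⁻¹' A) fun z => 1 / m *
      (c * TelegraphFilter.phi (σ * √h) (z - (p + d * h)) +
        ∫ u in (0 : ℝ)..h, TelegraphFilter.phi (σ * √h) (z - (p + d * u)) * κ u) := by
  have hs : 0 ≤ σ * √(h : ℝ) := by positivity
  set F : ℝ → ℝ := fun z => c * TelegraphFilter.phi (σ * √h) (z - (p + d * h)) +
    ∫ u in (0 : ℝ)..h, TelegraphFilter.phi (σ * √h) (z - (p + d * u)) * κ u with hF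
  have hPA' : P (X ⁻¹' A) = ENNReal.ofReal (C * m) := by
    rw [← hPA, ofReal_measureReal]
  have hFm : Measurable F := by
    have h1 := continuous_phi (σ * √h)
    refine Continuous.measurable ((by fun_prop : Continuous fun z =>
      c * TelegraphFilter.phi (σ * √h) (z - (p + d * h))).add ?_)
    apply intervalIntegral.continuous_parametric_intervalIntegral_of_continuous'
    exact (h1.comp (by fun_prop : Continuous fun q : ℝ × ℝ => q.1 - (p + d * q.2))).mul
      (hκ.comp continuous_snd)
  have hF0 : ∀ z, 0 ≤ F z := fun z => add_nonneg (mul_nonneg hc (phi_nonneg hs _))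
    (integral_mul_nonneg_of_Icc h.2 hκ0 fun u => phi_nonneg hs _)
  have hσV := gaussianReal_const_mul hV σ
  rw [mul_zero] at hσV
  have hv : NNReal.mk (σ ^ 2) (sq_nonneg _) * h ≠ 0 :=
    mul_ne_zero (fun h0 => (pow_pos hσ 2).ne' (congrArg NNReal.toReal h0)) hh.ne'
  have hlaw : (P.restrict (X ⁻¹' A)).map (fun ω => f (X ω)) = atomAddDensity C c h κ :=
    map_eq_atomAddDensity (hf.comp hX).aemeasurable (ae_restrict_of_ae hfb) hC.le hc h.2 hκ hκ0
      hexp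
  have hmap : (P.restrict (X ⁻¹' A)).map Z
      = volume.withDensity fun z => ENNReal.ofReal (C * F z) := by
    rw [Measure.map_congr (ae_restrict_of_ae hZ),
      map_restrict_add_eq_conv (f := fun e => p + d * f e) hX hσV.aemeasurable
        (hind.comp (φ := id) (ψ := fun x => σ * x) measurable_id (by fun_prop)) (by fun_prop) hA,
      hσV.map_eq, conv_gaussianReal_eq_withDensity _ hv]
    congr 1 with z
    have hphi : ∀ x, gaussianPDF 0 (.mk (σ ^ 2) (sq_nonneg _) * h) x
        = ENNReal.ofReal (TelegraphFilter.phi (σ * √h) x) := fun x => by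
      rw [gaussianPDF, gaussianPDFReal_eq_phi hσ]
    have hmm : (P.restrict (X ⁻¹' A)).map (fun ω => p + d * f (X ω))
        = (atomAddDensity C c h κ).map fun u => p + d * u := by
      rw [← hlaw, Measure.map_map (by fun_prop) (by fun_prop)]
      rfl
    have hpm := (continuous_phi (σ * √h)).measurable
    simp_rw [hphi]
    rw [hmm, lintegral_map (by fun_prop) (by fun_prop)]
    exact lintegral_atomAddDensity hC.le hc h.2 hκ hκ0
      (g := fun u => TelegraphFilter.phi (σ * √h) (z - (p + d * u)))
      ((continuous_phi _).comp (by fun_prop)) fun u => phi_nonneg hs _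
  have hne : P (X ⁻¹' A) ≠ 0 := by
    rw [hPA']; simpa using mul_pos hC hm
  refine ⟨hne, hFm.const_mul _, fun z => mul_nonneg (by positivity) (hF0 z), ?_, ?_⟩
  · refine AEMeasurable.mono_ac ?_ (cond_absolutelyContinuous)
    have hVm := hV.aemeasurable
    exact AEMeasurable.congr (by fun_prop : AEMeasurable (fun ω => p + d * f (X ω) + σ * V ω) P)
      (hZ.mono fun ω hω => hω.symm)
  · rw [ProbabilityTheory.cond, Measure.map_smul, hmap, hPA', ← withDensity_smul _ (by fun_prop)]
    congr 1 with z
    rw [Pi.smul_apply, smul_eq_mul, ← ENNReal.ofReal_inv_of_pos (mul_pos hC hm),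
      ← ENNReal.ofReal_mul (by positivity)]
    congr 1
    field_simp
    rfl

end GaussianConvolution

/-! ### Change of variables between occupation time and integrated signal -/

section ChangeOfVariables

open TelegraphFilter

variable {a b σ h : ℝ} {q κ : ℝ → ℝ}

theorem inv_abs_mul_convIntegral (hb : b ≠ 0) (hh : 0 ≤ h)
    (hq : ∀ u ∈ Ioo 0 h, q (2 * u - h) = κ u / 2) (z : ℝ) :
    1 / |b| * convIntegral a b σ h q z
      = ∫ u in (0 : ℝ)..h, phi (σ * √h) (z - ((a - b) * h + 2 * b * u)) * κ u := by
  have h1 := intervalIntegral.integral_comp_add_mul (a := 0) (b := h)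
    (convIntegrand a b σ h q z) (mul_ne_zero two_ne_zero hb) ((a - b) * h)
  have h2 : ∫ u in (0 : ℝ)..h, phi (σ * √h) (z - ((a - b) * h + 2 * b * u)) * κ u
      = 2 * ∫ u in (0 : ℝ)..h, convIntegrand a b σ h q z ((a - b) * h + 2 * b * u) := by
    rw [← intervalIntegral.integral_const_mul, intervalIntegral.integral_of_le hh,
      intervalIntegral.integral_of_le hh, integral_Ioc_eq_integral_Ioo,
      integral_Ioc_eq_integral_Ioo]
    refine setIntegral_congr_fun measurableSet_Ioo fun u hu => ?_
    have h3 : ((a - b) * h + 2 * b * u - a * h) / b = 2 * u - h := by field_simp; ring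
    simp only [convIntegrand, h3, hq u hu]
    ring
  rw [h2, h1, smul_eq_mul, convIntegral]
  have e0 : (a - b) * h + 2 * b * 0 = h * (a - b) := by ring
  have e1 : (a - b) * h + 2 * b * h = h * (a + b) := by ring
  rw [e0, e1]
  -- For `b < 0` the substitution reverses the interval; this sign turns `1 / b` into `1 / |b|`.
  rcases lt_or_gt_of_ne hb with hb' | hb'
  · rw [abs_of_neg hb', sub_neg_eq_add, ← sub_eq_add_neg, intervalIntegral.integral_symm]
    field_simp
  · rw [abs_of_pos hb']
    field_simp

/-- On the open interval the integrand agrees with a continuous function, so its values at the end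
points do not matter. -/
theorem intervalIntegrable_convIntegrand (hb : b ≠ 0) (hh : 0 ≤ h) (hκ : Continuous κ)
    (hq : ∀ u ∈ Ioo 0 h, q (2 * u - h) = κ u / 2) (z : ℝ) :
    IntervalIntegrable (convIntegrand a b σ h q z) volume (h * (a - |b|)) (h * (a + |b|)) := by
  have hle : h * (a - |b|) ≤ h * (a + |b|) :=
    mul_le_mul_of_nonneg_left (by linarith [abs_nonneg b]) hh
  have hcont : Continuous fun x =>
      phi (σ * √h) (z - x) * (κ ((x - (a - b) * h) / (2 * b)) / 2) :=
    ((continuous_phi _).comp (by fun_prop)).mul ((hκ.comp (by fun_prop)).div_const 2)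
  rw [intervalIntegrable_iff_integrableOn_Ioo_of_le hle]
  refine IntegrableOn.congr_fun
    (hcont.integrableOn_Icc.mono_set Ioo_subset_Icc_self) (fun x hx => ?_) measurableSet_Ioo
  have hu : (x - (a - b) * h) / (2 * b) ∈ Ioo 0 h := by
    rcases lt_or_gt_of_ne hb with hb' | hb'
    · rw [abs_of_neg hb'] at hx
      constructor
      · exact div_pos_of_neg_of_neg (by linarith [hx.2]) (by linarith)
      · rw [div_lt_iff_of_neg (by linarith)]; linarith [hx.1]
    · rw [abs_of_pos hb'] at hx
      constructor
      · exact div_pos (by linarith [hx.1]) (by linarith)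
      · rw [div_lt_iff₀ (by linarith)]; linarith [hx.2]
  have h3 : (x - a * h) / b = 2 * ((x - (a - b) * h) / (2 * b)) - h := by field_simp; ring
  simp only [convIntegrand]
  rw [h3, hq _ hu]

end ChangeOfVariables

/-! ### Event probabilities and dependence on the path up to `h` -/

section Masses

open TelegraphFilter

/-- At `θ = 0` the perturbation disappears and the entry is a transition probability of the chain,
up to the factor `e^{-λh}`. -/
theorem evenSeries_zero_left (l h : ℝ) : evenSeries 0 l h = Real.cosh (l * h) := by
  have h1 := exp_symmetricQ_add_occupationMatrix 0 l h 0 0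
  have h2 := exp_symmetricQ l h 0 0
  have h3 : occupationMatrix 0 0 = 0 := by simp [occupationMatrix]
  rw [h3, add_zero, h2] at h1
  simpa using h1.symm

theorem oddSeries_zero_left (l h : ℝ) : oddSeries 0 l h = Real.sinh (l * h) := by
  have h1 := exp_symmetricQ_add_occupationMatrix 0 l h 0 1
  have h2 := exp_symmetricQ l h 0 1
  have h3 : occupationMatrix 0 0 = 0 := by simp [occupationMatrix]
  rw [h3, add_zero, h2] at h1
  simpa using h1.symm

theorem occupationTime_congr {d : ℕ} (i : Fin d) {h : ℝ≥0} {x y : ℝ≥0 → Fin d}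
    (hxy : ∀ t ≤ h, x t = y t) : occupationTime i h x = occupationTime i h y := by
  have h1 : rightRiemannSum (stateIndicator i x) h = rightRiemannSum (stateIndicator i y) h :=
    funext fun n => rightRiemannSum_congr (fun t ht => by simp only [stateIndicator, hxy t ht]) n
  rw [occupationTime, h1, occupationTime]

end Masses

end

/-! ### Assembly of the theorem -/

theorem theorem3p1 {Ω : Type*} [MeasurableSpace Ω] (P : Measure Ω) [IsProbabilityMeasure P]
    (T h : ℝ≥0) (hh : 0 < h) (hT : h ≤ T)
    (α : Fin 2 → ℝ) (hα : α 0 ≠ α 1) (σ : ℝ) (hσ : 0 < σ) (l : ℝ) (hl : 0 < l)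
    (p₀ : Fin 2 → ℝ) (ε : ℝ≥0 → Ω → Fin 2) (W : ℝ≥0 → Ω → ℝ)
    (hε : TelegraphFilter.IsMarkovChainOn (TelegraphFilter.symmetricQ l) p₀ T ε P)
    (hW : TelegraphFilter.IsBrownianOn T W P)
    (hind : IndepFun (fun ω (t : Set.Iic T) => ε t ω) (fun ω (t : Set.Iic T) => W t ω) P)
    (i : Fin 2) (hi : p₀ i ≠ 0) :
    -- the integrals in the formulas converge
    (∀ q ∈ ({TelegraphFilter.qTotal h l, TelegraphFilter.qPlus h l,
          TelegraphFilter.qMinus h l} : Set (ℝ → ℝ)), ∀ z : ℝ,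
      IntervalIntegrable
        (TelegraphFilter.convIntegrand (TelegraphFilter.mean α) (TelegraphFilter.halfDiff α i)
          σ h q z) volume
        (h * (TelegraphFilter.mean α - |TelegraphFilter.halfDiff α i|))
        (h * (TelegraphFilter.mean α + |TelegraphFilter.halfDiff α i|))) ∧
    -- given `ε₀ = i`
    TelegraphFilter.HasCondDensity (TelegraphFilter.observation α σ ε W h) P
      {ω | ε 0 ω = i}
      (TelegraphFilter.gInit (TelegraphFilter.mean α) (TelegraphFilter.halfDiff α i) σ l h) ∧
    -- given `ε₀ = εₕ = i`
    TelegraphFilter.HasCondDensity (TelegraphFilter.observation α σ ε W h) P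
      {ω | ε 0 ω = i ∧ ε h ω = i}
      (TelegraphFilter.gSame (TelegraphFilter.mean α) (TelegraphFilter.halfDiff α i) σ l h) ∧
    -- given `ε₀ = i` and `εₕ = j ≠ i`
    ∀ j : Fin 2, j ≠ i →
      TelegraphFilter.HasCondDensity (TelegraphFilter.observation α σ ε W h) P
        {ω | ε 0 ω = i ∧ ε h ω = j}
        (TelegraphFilter.gDiff (TelegraphFilter.mean α) (TelegraphFilter.halfDiff α i) σ l h) := by
  obtain ⟨j, hji⟩ : ∃ j : Fin 2, j ≠ i := exists_ne i
  have hh' : (0 : ℝ) < h := hh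
  set a := TelegraphFilter.mean α with ha
  set b := TelegraphFilter.halfDiff α i with hb
  have hab : α j = a - b ∧ α i = a + b := by
    fin_cases i <;> fin_cases j <;>
      simp_all [TelegraphFilter.mean, TelegraphFilter.halfDiff] <;> constructor <;> ring
  have hb0 : b ≠ 0 := by
    fin_cases i <;> simp [hb, TelegraphFilter.halfDiff, sub_eq_zero, hα, hα.symm]
  have hqm : ∀ u ∈ Ioo 0 (h : ℝ),
      TelegraphFilter.qMinus h l (2 * u - h) = oddKernel l h u / 2 :=
    fun u hu => qMinus_eq l h u (Ioo_subset_Icc_self hu)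
  have hqp : ∀ u ∈ Ioo 0 (h : ℝ),
      TelegraphFilter.qPlus h l (2 * u - h) = evenKernel l h u / 2 :=
    fun u hu => qPlus_eq l h u (Ioo_subset_Ico_self hu)
  have hqt : ∀ u ∈ Ioo 0 (h : ℝ), TelegraphFilter.qTotal h l (2 * u - h)
      = (oddKernel l h u + evenKernel l h u) / 2 :=
    fun u hu => by rw [qTotal_eq, hqm u hu, hqp u hu]; ring
  have hco := continuous_oddKernel l h
  have hce := continuous_evenKernel l h
  -- The finite-dimensional law at the single time `0` says `p₀ i = P(ε_0 = i)`, hence it is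
  -- nonnegative.
  have hpi : 0 < p₀ i := by
    have h1 := hε.finiteDimensional 0 (fun _ => 0) monotone_const rfl zero_le fun _ => i
    simp only [Finset.univ_eq_empty, Finset.prod_empty, mul_one] at h1
    exact lt_of_le_of_ne (h1 ▸ measureReal_nonneg) hi.symm
  have hC : 0 < p₀ i * Real.exp (-l * h) := mul_pos hpi (Real.exp_pos _)
  -- the path of the chain and the occupation time as a function of it
  set X : Ω → Set.Iic T → Fin 2 := fun ω t => ε t ω with hXdef
  have hX : Measurable X := measurable_pi_lambda _ fun t => hε.measurable t t.2
  -- Independence concerns paths indexed by `[0, T]`. Freezing a path at `T` extends it to all times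
  -- without changing the occupation time before `h ≤ T`.
  set f : (Set.Iic T → Fin 2) → ℝ := fun x =>
    occupationTime i h fun t => x ⟨min t T, min_le_right t T⟩ with hfdef
  have hf : Measurable f := measurable_occupationTime i h fun t _ => measurable_pi_apply _
  have hfX : ∀ ω, f (X ω) = occupationTime i h fun t => ε t ω := fun ω =>
    occupationTime_congr i fun t ht => by simp only [hXdef, min_eq_left (ht.trans hT)]
  have hrc : ∀ᵐ ω ∂P, ∀ t < h, ContinuousWithinAt (fun s => ε s ω) (Ici t) t :=
    hε.rightContinuous.mono fun ω hω t ht => hω t (ht.trans_le hT)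
  have hfb : ∀ᵐ ω ∂P, f (X ω) ∈ Icc 0 (h : ℝ) := by
    filter_upwards [hrc] with ω hω
    rw [hfX]
    exact occupationTime_mem_Icc i hh hω
  have hZ : ∀ᵐ ω ∂P, TelegraphFilter.observation α σ ε W h ω
      = (a - b) * h + 2 * b * f (X ω) + σ * W h ω := by
    filter_upwards [hrc] with ω hω
    rw [TelegraphFilter.observation, integral_eq_occupationTime α hji hh hω, hfX, hab.1, hab.2]
    ring
  have hV : HasLaw (W h) (gaussianReal 0 h) P :=
    (BrownianReal.measurePreserving_eval_projectiveFamily (I := {h}) ⟨h, by simp⟩).hasLaw.comp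
      (hW.hasLaw {h} (by simpa using hT))
  have hXV : IndepFun X (W h) P :=
    hind.comp (φ := id) (ψ := fun w : Set.Iic T → ℝ => w ⟨h, hT⟩) measurable_id
      (measurable_pi_apply (⟨h, hT⟩ : Set.Iic T))
  -- the Laplace transforms on the events
  have hE : ∀ (k : Fin 2) (θ : ℝ), ∫ ω in {ω | ε 0 ω = i ∧ ε h ω = k}, Real.exp (θ * f (X ω)) ∂P
      = p₀ i * Real.exp (-l * h) * if k = i then evenSeries θ l h else oddSeries θ l h := by
    intro k θ
    simp_rw [hfX]
    exact setIntegral_exp_occupationTime hε hh hT θ i k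
  have hev : ∀ t : Set.Iic T, Measurable fun x : Set.Iic T → Fin 2 => x t := fun t =>
    measurable_pi_apply t
  have hmeas : ∀ k : Fin 2, MeasurableSet {x : Set.Iic T → Fin 2 | x ⟨h, hT⟩ = k} := fun k =>
    hev _ (measurableSet_singleton k)
  have hmeas0 : MeasurableSet {x : Set.Iic T → Fin 2 | x ⟨0, mem_Iic.mpr zero_le⟩ = i} :=
    hev _ (measurableSet_singleton i)
  have hmass : ∀ A : Set Ω, ∫ ω in A, Real.exp (0 * f (X ω)) ∂P = P.real A := by
    intro A; simp
  have hEi : ∀ θ : ℝ, ∫ ω in {ω | ε 0 ω = i}, Real.exp (θ * f (X ω)) ∂P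
      = p₀ i * Real.exp (-l * h) * (evenSeries θ l h + oddSeries θ l h) := by
    intro θ
    have hu : {ω | ε 0 ω = i} = {ω | ε 0 ω = i ∧ ε h ω = i} ∪ {ω | ε 0 ω = i ∧ ε h ω = j} := by
      ext ω
      have : ε h ω = i ∨ ε h ω = j := by omega
      simp only [mem_union, mem_ofPred_eq]
      tauto
    have hint : Integrable (fun ω => Real.exp (θ * f (X ω))) P :=
      integrable_exp_mul_of_mem_Icc (hf.comp hX).aemeasurable hfb
    have hj : MeasurableSet {ω | ε 0 ω = i ∧ ε h ω = j} := hX (hmeas0.inter (hmeas j))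
    rw [hu, setIntegral_union _ hj hint.integrableOn hint.integrableOn,
      hE, hE, if_pos rfl, if_neg hji, mul_add]
    rw [Set.disjoint_left]
    intro ω h1 h2
    exact hji (h2.2.symm.trans h1.2)
  refine ⟨?_, ?_, ?_, ?_⟩
  · intro q hq z
    simp only [mem_insert_iff, mem_singleton_iff] at hq
    rcases hq with rfl | rfl | rfl
    · exact intervalIntegrable_convIntegrand hb0 hh'.le (hco.add hce) hqt z
    · exact intervalIntegrable_convIntegrand hb0 hh'.le hce hqp z
    · exact intervalIntegrable_convIntegrand hb0 hh'.le hco hqm z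
  -- Both parities contribute, so the mass factor is `cosh + sinh = exp`, whose inverse is the
  -- prefactor `e^{-λh}`.
  · have key := hasCondDensity_of_integral_exp (c := 1) (m := Real.exp (l * h))
      (κ := fun u => oddKernel l h u + evenKernel l h u) hh hσ hX hV hXV hf hfb hmeas0 hZ hC
      zero_le_one (Real.exp_pos _) (hco.add hce)
      (fun u hu => add_nonneg (oddKernel_nonneg hl.le hu) (evenKernel_nonneg hu))
      (by
        rw [← hmass]
        refine (hEi 0).trans ?_
        rw [evenSeries_zero_left, oddSeries_zero_left, Real.cosh_add_sinh])
      (fun θ => by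
        refine (hEi θ).trans ?_
        rw [← integral_exp_mul_evenKernel, ← integral_exp_mul_oddKernel, add_assoc,
          ← intervalIntegral.integral_add (Continuous.intervalIntegrable (by fun_prop) _ _)
            (Continuous.intervalIntegrable (by fun_prop) _ _), one_mul]
        congr 3 with u
        ring_nf)
    convert! key using 1
    ext z
    rw [TelegraphFilter.gInit, inv_abs_mul_convIntegral hb0 hh'.le hqt, one_mul, neg_mul,
      Real.exp_neg, one_div]
    congr 4
    ring
  · have key := hasCondDensity_of_integral_exp (c := 1) (m := Real.cosh (l * h))
      (κ := evenKernel l h) hh hσ hX hV hXV hf hfb (hmeas0.inter (hmeas i)) hZ hC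
      zero_le_one (Real.cosh_pos _) hce (fun u hu => evenKernel_nonneg hu)
      (by
        rw [← hmass]
        refine (hE i 0).trans ?_
        rw [if_pos rfl, evenSeries_zero_left])
      (fun θ => by
        refine (hE i θ).trans ?_
        rw [if_pos rfl, ← integral_exp_mul_evenKernel, one_mul])
    convert! key using 1
    ext z
    rw [TelegraphFilter.gSame, inv_abs_mul_convIntegral hb0 hh'.le hqp, one_mul]
    congr 4
    ring
  · intro k hk
    -- Ending in the other state requires at least one jump, so there is no atom.
    have key := hasCondDensity_of_integral_exp (c := 0) (m := Real.sinh (l * h))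
      (κ := oddKernel l h) hh hσ hX hV hXV hf hfb (hmeas0.inter (hmeas k)) hZ hC
      le_rfl (Real.sinh_pos_iff.mpr (mul_pos hl hh')) hco (fun u hu => oddKernel_nonneg hl.le hu)
      (by
        rw [← hmass]
        refine (hE k 0).trans ?_
        rw [if_neg hk, oddSeries_zero_left])
      (fun θ => by
        refine (hE k θ).trans ?_
        rw [if_neg hk, ← integral_exp_mul_oddKernel, zero_mul, zero_add])
    convert! key using 1
    ext z
    rw [TelegraphFilter.gDiff, zero_mul, zero_add, ← inv_abs_mul_convIntegral hb0 hh'.le hqm,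
      ← mul_assoc, one_div_mul_one_div]
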